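/- Let $n,k\ge 0$ be integers. A simple polygon is the closed region $P\subset\mathbb{R}^2$ bounded by a closed polygonal chain with at least three pairwise distinct vertices in which consecutive edges meet only in their common vertex and non-consecutive edges are disjoint (straight angles at vertices are allowed). For a finite set $S\subset\mathbb{R}^2$ let $\mathcal{P}(S)$ be the set of all simple polygons whose vertex set is exactly $S$. A point $p\in P$ sees a point $q\in P$ if the segment $pq$ is contained in $P$, and a set $G\subseteq S$ is a guard set for $P$ if every point of $P$ is seen, with respect to $P$, by some $g\in G$; it is a guard set for $A\subseteq\mathcal{P}(S)$ if it is a guard set for every $P\in A$. Let $g_k(n)$ denote the maximum, over all sets $S$ of $n$ points in the plane and all sets $A\subseteq\mathcal{P}(S)$ with $|A|=k$, of the minimum cardinality of a guard set $G\subseteq S$ for $A$ (with $g_k(n)=0$ if there is no such pair $(S,A)$). **Theorem.** For all $n$ and $k$, $$g_k(n)\;\le\;\left(1-\left(\tfrac23\right)^k\right)n .$$ Equivalently, for every set $S$ of $n$ points in the plane and every set $A$ of $k$ simple polygons with vertex set $S$ there is a set $G\subseteq S$ with $|G|\le\left(1-(2/3)^k\right)n$ that is a guard set for every polygon in $A$.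 -/

import Mathlib

open scoped ENNReal

/-- The Euclidean plane. -/
abbrev Plane : Type := EuclideanSpace ℝ (Fin 2)

namespace Polygon

variable {m : ℕ}

/-- A closed polygonal chain in the plane with at least three vertices is *simple* if its vertices
are pairwise distinct, consecutive edges meet exactly in their common vertex, and non-consecutive
edges are disjoint. Consecutive edges may be collinear (a vertex may have a straight angle). -/
structure IsSimple (c : Polygon Plane m) : Prop where
  three_le : 3 ≤ m
  injective : Function.Injective c.vertices
  consecutive : ∀ i : Fin m,
    c.edgeSet ℝ i ∩ c.edgeSet ℝ (finRotate m i) = {c.vertices (finRotate m i)}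
  nonconsecutive : ∀ i j : Fin m, i ≠ j → j ≠ finRotate m i → i ≠ finRotate m j →
    Disjoint (c.edgeSet ℝ i) (c.edgeSet ℝ j)

/-- The closed region enclosed by a closed polygonal chain: the chain itself together with all
points that lie in a bounded connected component of its complement. -/
def region (c : Polygon Plane m) : Set Plane :=
  c.boundary ℝ ∪
    {x | x ∉ c.boundary ℝ ∧
      Bornology.IsBounded (connectedComponentIn (c.boundary ℝ)ᶜ x)}

end Polygon

namespace UniversalGuards

/-- The set of all simple polygons (as closed regions of the plane) with vertex set `S`. -/
def simplePolygons (S : Finset Plane) : Set (Set Plane) :=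
  {P | ∃ (m : ℕ) (c : Polygon Plane m),
    c.IsSimple ∧ Set.range c.vertices = (S : Set Plane) ∧ P = c.region}

/-- The points `p` and `q` of `P` see each other if the segment joining them lies in `P`. -/
def Sees (P : Set Plane) (p q : Plane) : Prop :=
  p ∈ P ∧ q ∈ P ∧ segment ℝ p q ⊆ P

/-- The visible region of the point `g` with respect to `P`. -/
def visibleRegion (P : Set Plane) (g : Plane) : Set Plane :=
  {a | a ∈ P ∧ Sees P g a}

/-- `G` is a guard set for `P`: the visible regions of the points of `G` together make up `P`. -/
def IsGuardSet (P : Set Plane) (G : Finset Plane) : Prop :=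
  ⋃ g ∈ G, visibleRegion P g = P

/-- `G ⊆ S` is a guard set for each member of the family `A` of polygons with vertex set `S`. -/
def IsCommonGuardSet (S : Finset Plane) (A : Set (Set Plane)) (G : Finset Plane) : Prop :=
  G ⊆ S ∧ ∀ P ∈ A, IsGuardSet P G

/-- The minimum cardinality of a common guard set `G ⊆ S` of the family `A`
(it would be `⊤` if there were no common guard set). -/
noncomputable def minGuards (S : Finset Plane) (A : Set (Set Plane)) : ℕ∞ :=
  ⨅ (G : Finset Plane) (_ : IsCommonGuardSet S A G), (G.card : ℕ∞)

/-- The `k`-universal guard number for simple polygons: the maximum of `minGuards S A` over all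
sets `S` of `n` points in the plane and all sets `A` of exactly `k` simple polygons with vertex
set `S`. -/
noncomputable def kUniversalGuardNumber (n k : ℕ) : ℕ∞ :=
  ⨆ (S : Finset Plane) (_ : S.card = n) (A : Set (Set Plane))
    (_ : A ⊆ simplePolygons S) (_ : A.encard = (k : ℕ∞)), minGuards S A

end UniversalGuards

/-! The core is Fisk's argument, iterated. The vertices of a simple polygon can be coloured with
three colours so that every colour class is a guard set (`exists_guard_coloring`). Once guards for
some of the polygons are chosen, the next polygon is served by adding its colour class with the
fewest unchosen points. At least two thirds of the unchosen points stay unchosen, so after `k`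
polygons at least `(2/3)^k * n` of them remain (`exists_guards_card_sdiff`).

The colouring is built by induction on the number of vertices (`exists_coloring`). A diagonal cuts
the polygon into two smaller ones; their colourings are matched on the diagonal by permuting
colours, and a point sees all three colours already inside a piece that contains it. A triangle is
convex, so each of its vertices is a guard.

The region is defined through bounded components of the complement of the chain, so the cutting step
needs a computable description of it. This is the total angle, `2π` times the winding number:
constant on connected sets missing the chain, zero on unbounded ones, and additive when a chain is
cut along a diagonal. Points with nonzero total angle are therefore enclosed. The converse
`totalAngle_ne_zero` uses that the chain has two local sides, that every component of the complement
is adherent to the whole chain, and that the total angle jumps across an edge. With total angle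
zero, a bounded and an unbounded component would occupy the two sides of an edge and leave no jump.
Additivity then gives `enclosed_subset_union`.

Diagonals are found at a vertex of maximal norm, whose corner is strictly convex with its sector
locally enclosed. Either its neighbours can be joined, or the vertex can be joined to the vertex of
the corner triangle nearest to it in affine height (`exists_diagonal_of_max`). -/

namespace PlaneChain

open Set Filter Topology Complex

/-! ### Closed polygonal chains in the complex plane -/

/-- The edge of the chain `f` from `f i` to `f (i + 1)`. -/
def edge (f : ℕ → ℂ) (i : ℕ) : Set ℂ := segment ℝ (f i) (f (i + 1))

/-- The union of the first `m` edges of the chain `f`. -/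
def carrier (f : ℕ → ℂ) (m : ℕ) : Set ℂ := {z | ∃ i < m, z ∈ edge f i}

/-- A closed polygonal chain with `m` vertices, given as a periodic sequence of points, is simple
if distinct edges meet only in a common vertex. -/
structure IsSimpleChain (f : ℕ → ℂ) (m : ℕ) : Prop where
  three_le : 3 ≤ m
  periodic : ∀ i, f (i + m) = f i
  inj : ∀ i < m, ∀ j < m, f i = f j → i = j
  meet : ∀ i j, i < j → j < m → ∀ y ∈ edge f i, y ∈ edge f j →
    (j = i + 1 ∧ y = f j) ∨ (i = 0 ∧ j + 1 = m ∧ y = f 0)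

theorem left_mem_edge (f : ℕ → ℂ) (i : ℕ) : f i ∈ edge f i := left_mem_segment ℝ _ _

theorem right_mem_edge (f : ℕ → ℂ) (i : ℕ) : f (i + 1) ∈ edge f i := right_mem_segment ℝ _ _

theorem isCompact_segment (a b : ℂ) : IsCompact (segment ℝ a b) := by
  rw [segment_eq_image_lineMap]
  exact isCompact_Icc.image AffineMap.lineMap_continuous

theorem isCompact_edge (f : ℕ → ℂ) (i : ℕ) : IsCompact (edge f i) := isCompact_segment _ _

theorem carrier_succ (f : ℕ → ℂ) (m : ℕ) : carrier f (m + 1) = carrier f m ∪ edge f m := by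
  ext z
  simp only [carrier, mem_ofPred_eq, mem_union, Nat.lt_succ_iff_lt_or_eq]
  constructor
  · rintro ⟨i, h | rfl, hz⟩
    exacts [Or.inl ⟨i, h, hz⟩, Or.inr hz]
  · rintro (⟨i, h, hz⟩ | hz)
    exacts [⟨i, Or.inl h, hz⟩, ⟨m, Or.inr rfl, hz⟩]

theorem carrier_zero (f : ℕ → ℂ) : carrier f 0 = ∅ := by
  ext z
  simp [carrier]

theorem isCompact_carrier (f : ℕ → ℂ) (m : ℕ) : IsCompact (carrier f m) := by
  induction m with
  | zero => simp [carrier_zero]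
  | succ m ih => rw [carrier_succ]; exact ih.union (isCompact_edge f m)

theorem isPreconnected_carrier (f : ℕ → ℂ) (m : ℕ) : IsPreconnected (carrier f m) := by
  induction m with
  | zero => simpa [carrier_zero] using isPreconnected_empty
  | succ m ih =>
    rw [carrier_succ]
    have h : IsPreconnected (edge f m) := (convex_segment _ _).isPreconnected
    rcases m with _ | m
    · simpa [carrier_zero] using h
    · exact ih.union (f (m + 1)) ⟨m, by omega, right_mem_edge f m⟩ (left_mem_edge f _) h

namespace IsSimpleChain

variable {f : ℕ → ℂ} {m : ℕ}

theorem zero_eq (h : IsSimpleChain f m) : f m = f 0 := by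
  simpa using h.periodic 0

theorem succ_eq (h : IsSimpleChain f m) : f (m + 1) = f 1 := by
  simpa [add_comm] using h.periodic 1

theorem edge_period (h : IsSimpleChain f m) : edge f m = edge f 0 := by
  simp [edge, h.zero_eq, h.succ_eq]

theorem vertex_mem_edge (h : IsSimpleChain f m) {k i : ℕ} (hk : k < m) (hi : i < m)
    (hm : f k ∈ edge f i) : k = i ∨ k = i + 1 ∨ (k = 0 ∧ i + 1 = m) := by
  rcases lt_trichotomy k i with hlt | heq | hlt
  · rcases h.meet k i hlt hi _ (left_mem_edge f k) hm with ⟨_, h2⟩ | ⟨h1, h2, _⟩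
    · exact Or.inl (h.inj _ hk _ hi h2)
    · exact Or.inr (Or.inr ⟨h1, h2⟩)
  · exact Or.inl heq
  · rcases h.meet i k hlt hk _ hm (left_mem_edge f k) with ⟨h1, _⟩ | ⟨h1, h2, h3⟩
    · exact Or.inr (Or.inl h1)
    · have := h.inj _ hk 0 (by omega) h3
      omega

/-- Cyclic renumbering allows any vertex or edge to be treated as number `0`. The cases separate
indices below `m` from the one that wraps around. -/
theorem shift_one (h : IsSimpleChain f m) : IsSimpleChain (fun i => f (i + 1)) m := by
  have h3 := h.three_le
  have hE : ∀ i, edge (fun i => f (i + 1)) i = edge f (i + 1) := fun i => rfl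
  refine ⟨h3, fun i => ?_, fun i hi j hj hij => ?_, fun i j hij hj y hyi hyj => ?_⟩
  · simpa [add_right_comm] using h.periodic (i + 1)
  · by_cases hi' : i + 1 < m <;> by_cases hj' : j + 1 < m
    · have := h.inj _ hi' _ hj' hij
      omega
    · have e : j + 1 = m := by omega
      simp only [e, h.zero_eq] at hij
      have := h.inj _ hi' 0 (by omega) hij
      omega
    · have e : i + 1 = m := by omega
      simp only [e, h.zero_eq] at hij
      have := h.inj 0 (by omega) _ hj' hij
      omega
    · omega
  · rw [hE] at hyi hyj
    by_cases hj' : j + 1 < m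
    · rcases h.meet (i + 1) (j + 1) (by omega) hj' y hyi hyj with ⟨h1, h2⟩ | ⟨h1, h2, _⟩
      · exact Or.inl ⟨by omega, h2⟩
      · omega
    · have e : j + 1 = m := by omega
      rw [e, h.edge_period] at hyj
      rcases h.meet 0 (i + 1) (by omega) (by omega) y hyj hyi with ⟨h1, h2⟩ | ⟨_, h1, h2⟩
      · exact Or.inr ⟨by omega, e, by simpa [show i = 0 by omega] using h2⟩
      · exact Or.inl ⟨by omega, by simp only [e, h.zero_eq, h2]⟩

theorem shift (h : IsSimpleChain f m) (r : ℕ) : IsSimpleChain (fun i => f (i + r)) m := by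
  induction r with
  | zero => exact h
  | succ r ih => simpa [add_assoc, add_comm 1] using ih.shift_one

theorem periodic_mod (h : IsSimpleChain f m) (i : ℕ) : f (i % m) = f i := by
  have hp : Function.Periodic f m := h.periodic
  exact hp.map_mod_nat i

theorem edge_mod (h : IsSimpleChain f m) (i : ℕ) : edge f (i % m) = edge f i := by
  unfold edge
  rw [h.periodic_mod i, ← h.periodic_mod (i % m + 1), Nat.mod_add_mod, h.periodic_mod]

theorem edge_subset_carrier (h : IsSimpleChain f m) (i : ℕ) : edge f i ⊆ carrier f m :=
  fun z hz => ⟨i % m, Nat.mod_lt _ (by have := h.three_le; omega), by rwa [h.edge_mod]⟩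

theorem carrier_shift (h : IsSimpleChain f m) (r : ℕ) :
    carrier (fun i => f (i + r)) m = carrier f m := by
  have hE : ∀ i, edge (fun i => f (i + r)) i = edge f (i + r) := by
    intro i; simp [edge, add_right_comm]
  have h3 := h.three_le
  apply Subset.antisymm
  · rintro z ⟨i, hi, hz⟩
    rw [hE] at hz
    exact h.edge_subset_carrier _ hz
  · rintro z ⟨i, hi, hz⟩
    apply (h.shift r).edge_subset_carrier (i + (m - r % m))
    rw [hE, ← h.edge_mod]
    have : (i + (m - r % m) + r) % m = i := by
      have h1 := Nat.mod_lt r (show 0 < m by omega)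
      have h2 := Nat.mod_add_div r m
      have : i + (m - r % m) + r = i + m * (1 + r / m) := by
        rw [mul_add]; omega
      rw [this, Nat.add_mul_mod_self_left, Nat.mod_eq_of_lt hi]
    rwa [this]

end IsSimpleChain

/-- The closed chain formed by the vertices `f 0, …, f j`. -/
def subChain (f : ℕ → ℂ) (j : ℕ) : ℕ → ℂ := fun i => f (i % (j + 1))

theorem subChain_apply {f : ℕ → ℂ} {i j : ℕ} (h : i ≤ j) : subChain f j i = f i := by
  simp [subChain, Nat.mod_eq_of_lt (Nat.lt_succ_of_le h)]

theorem edge_subChain {f : ℕ → ℂ} {i j : ℕ} (h : i < j) : edge (subChain f j) i = edge f i := by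
  rw [edge, edge, subChain_apply h.le, subChain_apply h]

theorem edge_subChain_last (f : ℕ → ℂ) (j : ℕ) :
    edge (subChain f j) j = segment ℝ (f j) (f 0) := by
  rw [edge, subChain_apply le_rfl]
  simp [subChain]

theorem carrier_subChain (f : ℕ → ℂ) (j : ℕ) :
    carrier (subChain f j) (j + 1) = carrier f j ∪ segment ℝ (f 0) (f j) := by
  rw [carrier_succ, edge_subChain_last, segment_symm]
  congr 1
  ext z
  simp only [carrier, mem_ofPred_eq]
  exact exists_congr fun i => and_congr_right fun hi => by rw [edge_subChain hi]

theorem mem_openSegment_or {a b z : ℂ} (h : z ∈ segment ℝ a b) :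
    z = a ∨ z = b ∨ z ∈ openSegment ℝ a b := by
  rw [← insert_endpoints_openSegment] at h
  simpa using h

/-- The only new edge is the diagonal. Its interior misses the old chain, so it can meet an old edge
only at its own endpoints, where `vertex_mem_edge` identifies the edge. -/
theorem IsSimpleChain.subChain {f : ℕ → ℂ} {m j : ℕ} (h : IsSimpleChain f m) (h2 : 2 ≤ j)
    (hj : j + 2 ≤ m) (hd : Disjoint (openSegment ℝ (f 0) (f j)) (carrier f m)) :
    IsSimpleChain (subChain f j) (j + 1) := by
  refine ⟨by omega, fun i => by simp [PlaneChain.subChain], fun i hi k hk hik => ?_,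
    fun i k hik hk y hyi hyk => ?_⟩
  · rw [subChain_apply (by omega), subChain_apply (by omega)] at hik
    exact h.inj _ (by omega) _ (by omega) hik
  · rw [edge_subChain (by omega)] at hyi
    rw [subChain_apply (by omega), subChain_apply (by omega)]
    by_cases hkj : k < j
    · rw [edge_subChain hkj] at hyk
      rcases h.meet i k hik (by omega) y hyi hyk with h1 | ⟨_, h1, _⟩
      · exact Or.inl h1
      · omega
    · obtain rfl : k = j := by omega
      rw [edge_subChain_last] at hyk
      rcases mem_openSegment_or hyk with rfl | rfl | h1
      · rcases h.vertex_mem_edge (by omega) (by omega) hyi with h1 | h1 | h1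
        · omega
        · exact Or.inl ⟨h1, rfl⟩
        · omega
      · rcases h.vertex_mem_edge (by omega) (by omega) hyi with h1 | h1 | h1
        · exact Or.inr ⟨h1.symm, rfl, rfl⟩
        · omega
        · omega
      · rw [openSegment_symm] at h1
        exact absurd ⟨i, by omega, hyi⟩ (disjoint_left.1 hd h1)

/-! ### The enclosed region of a set -/

/-- The set `K` together with the bounded components of its complement. -/
def enclosed (K : Set ℂ) : Set ℂ :=
  K ∪ {x | x ∉ K ∧ Bornology.IsBounded (connectedComponentIn Kᶜ x)}

theorem enclosed_of_component {K : Set ℂ} {x y : ℂ} (hx : x ∈ enclosed K)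
    (hy : y ∈ connectedComponentIn Kᶜ x) : y ∈ enclosed K := by
  have hyK : y ∈ Kᶜ := connectedComponentIn_subset _ _ hy
  rcases hx with hx | hx
  · rw [connectedComponentIn_eq_empty (by simpa using hx)] at hy
    exact hy.elim
  · exact Or.inr ⟨hyK, by rw [← connectedComponentIn_eq hy]; exact hx.2⟩

/-- Points that are joined by a connected set missing `K` are enclosed simultaneously. -/
theorem enclosed_of_isPreconnected {K s : Set ℂ} (hs : IsPreconnected s) (hK : Disjoint s K)
    {x y : ℂ} (hx : x ∈ s) (hy : y ∈ s) (h : x ∈ enclosed K) : y ∈ enclosed K :=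
  enclosed_of_component h
    (hs.subset_connectedComponentIn hx (subset_compl_iff_disjoint_right.2 hK) hy)

/-- The component in `Kᶜ` of a point not enclosed by `K` is unbounded and cannot touch the enclosed
set `d`. It therefore misses `L` and makes the component in `Lᶜ` unbounded too. With `d` a diagonal,
this places a cut-off piece inside the polygon. -/
theorem enclosed_subset {K d L : Set ℂ} (hL : L ⊆ K ∪ d) (hd : d ⊆ enclosed K) :
    enclosed L ⊆ enclosed K := by
  rintro x (hx | ⟨hx, hb⟩)
  · rcases hL hx with h | h
    exacts [Or.inl h, hd h]
  · by_contra hcon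
    have hxK : x ∉ K := fun h => hcon (Or.inl h)
    have hsub : connectedComponentIn Kᶜ x ⊆ Lᶜ := by
      intro y hy hyL
      rcases hL hyL with h | h
      · exact connectedComponentIn_subset _ _ hy h
      · exact hcon (enclosed_of_component (hd h)
          (by rw [← connectedComponentIn_eq hy]; exact mem_connectedComponentIn hxK))
    exact hcon (Or.inr ⟨hxK, hb.subset (isPreconnected_connectedComponentIn.subset_connectedComponentIn
      (mem_connectedComponentIn hxK) hsub)⟩)

/-! ### Total angle (winding number) -/

theorem div_mem_slitPlane {a b z : ℂ} (h : z ∉ segment ℝ a b) :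
    (b - z) / (a - z) ∈ slitPlane := by
  by_contra hn
  apply h
  have ha : a - z ≠ 0 := by
    intro h0
    apply h
    rw [← sub_eq_zero.1 h0]
    exact left_mem_segment ℝ _ _
  rw [mem_slitPlane_iff] at hn
  push Not at hn
  set r := -((b - z) / (a - z)).re with hr
  have hr0 : 0 ≤ r := by linarith [hn.1]
  have hq : (b - z) / (a - z) = -(r : ℂ) := by
    apply Complex.ext <;> simp [hr, hn.2]
  rw [div_eq_iff ha] at hq
  have h1 : (1 + r : ℂ) ≠ 0 := by
    norm_cast; positivity
  -- Solving `b - z = -r (a - z)` for `z` gives `z = (r a + b) / (1 + r)`, a convex combination.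
  refine ⟨r / (1 + r), 1 / (1 + r), by positivity, by positivity, by field_simp; ring, ?_⟩
  simp only [real_smul]
  push_cast
  field_simp
  linear_combination hq

/-- The angle under which the edge `f i`, `f (i + 1)` is seen from `z`. -/
noncomputable def edgeAngle (f : ℕ → ℂ) (z : ℂ) (i : ℕ) : ℝ := arg ((f (i + 1) - z) / (f i - z))

/-- The total angle swept by the first `m` edges of the chain `f`, seen from `z`. -/
noncomputable def totalAngle (f : ℕ → ℂ) (m : ℕ) (z : ℂ) : ℝ :=
  ∑ i ∈ Finset.range m, edgeAngle f z i

/-- Off the edge the quotient is never a nonpositive real, so the branch cut of `arg` is avoided. -/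
theorem continuousAt_edgeAngle {f : ℕ → ℂ} {z : ℂ} {i : ℕ} (h : z ∉ edge f i) :
    ContinuousAt (fun z => edgeAngle f z i) z := by
  have ha : f i - z ≠ 0 := fun h0 => h (by rw [← sub_eq_zero.1 h0]; exact left_mem_edge f i)
  have h1 : ContinuousAt (fun z => (f (i + 1) - z) / (f i - z)) z :=
    ContinuousAt.div (by fun_prop) (by fun_prop) ha
  exact ContinuousAt.comp (g := arg) (continuousAt_arg (div_mem_slitPlane h)) h1

theorem continuousOn_totalAngle (f : ℕ → ℂ) (m : ℕ) :
    ContinuousOn (totalAngle f m) (carrier f m)ᶜ := by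
  intro z hz
  apply ContinuousAt.continuousWithinAt
  exact tendsto_finsetSum _ fun i hi =>
    continuousAt_edgeAngle fun hzi => hz ⟨i, Finset.mem_range.1 hi, hzi⟩

/-- The quotients of successive vertices telescope, each contributing its modulus and its argument.
-/
theorem exp_totalAngle {f : ℕ → ℂ} {m : ℕ} {z : ℂ} (hz : z ∉ carrier f m) :
    ∃ r : ℝ, 0 < r ∧ f m - z = r * exp (totalAngle f m z * I) * (f 0 - z) := by
  induction m with
  | zero => exact ⟨1, one_pos, by simp [totalAngle]⟩
  | succ m ih =>
    rw [carrier_succ] at hz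
    obtain ⟨r, hr, h⟩ := ih fun h => hz (Or.inl h)
    have hzm : z ∉ edge f m := fun h => hz (Or.inr h)
    have ha : f m - z ≠ 0 := fun h0 => hzm (by rw [← sub_eq_zero.1 h0]; exact left_mem_edge f m)
    have hq := div_mem_slitPlane hzm
    have hq0 := slitPlane_ne_zero hq
    refine ⟨‖(f (m + 1) - z) / (f m - z)‖ * r, mul_pos (norm_pos_iff.2 hq0) hr, ?_⟩
    have h1 := norm_mul_exp_arg_mul_I ((f (m + 1) - z) / (f m - z))
    have h2 : f (m + 1) - z = (f (m + 1) - z) / (f m - z) * (f m - z) := by field_simp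
    set q := (f (m + 1) - z) / (f m - z) with hqdef
    have h3 : totalAngle f (m + 1) z
        = totalAngle f m z + arg q := by
      simp [totalAngle, Finset.sum_range_succ, edgeAngle, hqdef]
    rw [h2, h, h3]
    push_cast
    rw [add_mul, exp_add]
    linear_combination -(r * exp (totalAngle f m z * I) * (f 0 - z)) * h1

theorem exists_totalAngle_eq {f : ℕ → ℂ} {m : ℕ} {z : ℂ} (hm : f m = f 0)
    (hz : z ∉ carrier f m) : ∃ n : ℤ, totalAngle f m z = n * (2 * Real.pi) := by
  rcases Nat.eq_zero_or_pos m with rfl | hpos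
  · exact ⟨0, by simp [totalAngle]⟩
  obtain ⟨r, hr, h⟩ := exp_totalAngle hz
  rw [hm] at h
  have h0 : f 0 - z ≠ 0 := fun h0 =>
    hz ⟨0, hpos, by rw [← sub_eq_zero.1 h0]; exact left_mem_edge f 0⟩
  have h1 : (r : ℂ) * exp (totalAngle f m z * I) = 1 :=
    mul_right_cancel₀ h0 (by rw [one_mul]; exact h.symm)
  have h2 : r = 1 := by
    have := congrArg norm h1
    rw [norm_mul, norm_exp_ofReal_mul_I] at this
    simpa [abs_of_pos hr] using this
  rw [h2, ofReal_one, one_mul, exp_eq_one_iff] at h1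
  obtain ⟨n, hn⟩ := h1
  refine ⟨n, ?_⟩
  have h3 : (totalAngle f m z : ℂ) = n * (2 * Real.pi) :=
    mul_right_cancel₀ I_ne_zero (by rw [hn]; ring)
  exact_mod_cast h3

/-- A continuous function with values in `2πℤ` cannot vary on a connected set: an intermediate value
half a period above the smaller one would not be a multiple of `2π`. -/
theorem totalAngle_const {f : ℕ → ℂ} {m : ℕ} (hm : f m = f 0) {s : Set ℂ}
    (hs : IsPreconnected s) (hsK : s ⊆ (carrier f m)ᶜ) {x y : ℂ} (hx : x ∈ s) (hy : y ∈ s) :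
    totalAngle f m x = totalAngle f m y := by
  wlog hlt : totalAngle f m x < totalAngle f m y generalizing x y
  · rcases lt_trichotomy (totalAngle f m x) (totalAngle f m y) with h | h | h
    exacts [absurd h hlt, h, (this hy hx h).symm]
  obtain ⟨n, hn⟩ := exists_totalAngle_eq hm (hsK hx)
  obtain ⟨k, hk⟩ := exists_totalAngle_eq hm (hsK hy)
  have hpi := Real.pi_pos
  have hnk : (n : ℝ) + 1 ≤ k := by
    rw [hn, hk] at hlt
    have : (n : ℝ) < k := lt_of_mul_lt_mul_right hlt (by positivity)
    exact_mod_cast this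
  have hmid : (n : ℝ) * (2 * Real.pi) + Real.pi ∈ totalAngle f m '' s := by
    apply hs.intermediate_value hx hy ((continuousOn_totalAngle f m).mono hsK)
    rw [hn, hk]
    constructor <;> nlinarith
  obtain ⟨z, hz, hze⟩ := hmid
  obtain ⟨l, hl⟩ := exists_totalAngle_eq hm (hsK hz)
  rw [hze] at hl
  have h2 : (2 * n + 1 : ℝ) = 2 * l := by
    apply mul_right_cancel₀ hpi.ne'
    linarith
  have h3 : 2 * n + 1 = 2 * l := by exact_mod_cast h2
  omega

theorem tendsto_totalAngle (f : ℕ → ℂ) (m : ℕ) :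
    Tendsto (totalAngle f m) (Bornology.cobounded ℂ) (𝓝 0) := by
  rw [show (0 : ℝ) = ∑ i ∈ Finset.range m, 0 by simp]
  refine tendsto_finsetSum _ fun i _ => ?_
  have h1 : Tendsto (fun z => f i - z) (Bornology.cobounded ℂ) (Bornology.cobounded ℂ) := by
    rw [← tendsto_norm_atTop_iff_cobounded]
    refine tendsto_atTop_mono (fun z => ?_)
      (tendsto_atTop_add_const_right _ (-‖f i‖) (tendsto_norm_cobounded_atTop (E := ℂ)))
    have := norm_sub_norm_le z (f i)
    rw [norm_sub_rev] at this
    linarith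
  have h2 : Tendsto (fun z => 1 + (f (i + 1) - f i) * (f i - z)⁻¹) (Bornology.cobounded ℂ)
      (𝓝 1) := by
    simpa using tendsto_const_nhds.add
      (tendsto_const_nhds.mul ((tendsto_inv₀_cobounded (α := ℂ)).comp h1))
  have h3 : (fun z => 1 + (f (i + 1) - f i) * (f i - z)⁻¹) =ᶠ[Bornology.cobounded ℂ]
      fun z => (f (i + 1) - z) / (f i - z) := by
    have hne : ∀ᶠ z in Bornology.cobounded ℂ, f i - z ≠ 0 := h1.eventually_ne_cobounded 0
    filter_upwards [hne] with z hz
    field_simp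
    ring
  have h4 : Tendsto (fun z => edgeAngle f z i) (Bornology.cobounded ℂ) (𝓝 (arg 1)) :=
    ((continuousAt_arg (by simp)).tendsto).comp (h2.congr' h3)
  simpa using h4

/-- An unbounded set contains points far out, where the total angle is below `2π` in absolute value,
hence zero, being a multiple of `2π`. -/
theorem totalAngle_eq_zero {f : ℕ → ℂ} {m : ℕ} (hm : f m = f 0) {s : Set ℂ}
    (hs : IsPreconnected s) (hsK : s ⊆ (carrier f m)ᶜ) (hb : ¬ Bornology.IsBounded s)
    {x : ℂ} (hx : x ∈ s) : totalAngle f m x = 0 := by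
  have hev : ∀ᶠ z in Bornology.cobounded ℂ, |totalAngle f m z| < 2 * Real.pi := by
    have := (tendsto_totalAngle f m).abs
    rw [abs_zero] at this
    exact this.eventually_lt_const (by positivity)
  have hne : ∃ z ∈ s, |totalAngle f m z| < 2 * Real.pi := by
    by_contra! hcon
    apply hb
    rw [← Bornology.isCobounded_compl_iff]
    filter_upwards [hev] with z hz hzs
    exact absurd hz (not_lt.2 (hcon z hzs))
  obtain ⟨z, hz, hlt⟩ := hne
  rw [totalAngle_const hm hs hsK hx hz]
  obtain ⟨n, hn⟩ := exists_totalAngle_eq hm (hsK hz)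
  have hpi := Real.pi_pos
  rw [hn, abs_mul, abs_of_pos (by positivity : 0 < 2 * Real.pi)] at hlt
  have h1 : |(n : ℝ)| < 1 := by nlinarith
  have h2 : |n| < 1 := by exact_mod_cast h1
  rw [hn, Int.abs_lt_one_iff.1 h2]
  simp

theorem mem_enclosed_of_totalAngle {f : ℕ → ℂ} {m : ℕ} (hm : f m = f 0) {x : ℂ}
    (h : totalAngle f m x ≠ 0) : x ∈ enclosed (carrier f m) := by
  by_contra hcon
  have hx : x ∉ carrier f m := fun h => hcon (Or.inl h)
  exact h (totalAngle_eq_zero hm isPreconnected_connectedComponentIn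
    (connectedComponentIn_subset _ _) (fun hb => hcon (Or.inr ⟨hx, hb⟩))
    (mem_connectedComponentIn hx))

theorem totalAngle_eq_zero_of_notMem {f : ℕ → ℂ} {m : ℕ} (hm : f m = f 0) {x : ℂ}
    (h : x ∉ enclosed (carrier f m)) : totalAngle f m x = 0 := by
  by_contra hcon
  exact h (mem_enclosed_of_totalAngle hm hcon)

/-- Crossing the first edge at its midpoint changes the total angle. -/
theorem IsSimpleChain.exists_totalAngle_ne {f : ℕ → ℂ} {m : ℕ} (h : IsSimpleChain f m) {r : ℝ}
    (hr : 0 < r) : ∃ z₁ ∈ Metric.ball (midpoint ℝ (f 0) (f 1)) r,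
      ∃ z₂ ∈ Metric.ball (midpoint ℝ (f 0) (f 1)) r,
      z₁ ∉ carrier f m ∧ z₂ ∉ carrier f m ∧ totalAngle f m z₁ ≠ totalAngle f m z₂ := by
  have h3 := h.three_le
  set y := midpoint ℝ (f 0) (f 1) with hy
  set d := f 1 - f 0 with hd
  have hd0 : d ≠ 0 := fun h0 => by
    have := h.inj 1 (by omega) 0 (by omega) (sub_eq_zero.1 h0)
    omega
  have hye : y = f 0 + d / 2 := by
    rw [hy, hd, midpoint_eq_smul_add, real_smul]
    simp
    ring
  have hyE : y ∈ edge f 0 := midpoint_mem_segment _ _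
  have hyj : ∀ j ∈ Finset.range m, j ≠ 0 → y ∉ edge f j := by
    intro j hj hj0 hyj
    have hj := Finset.mem_range.1 hj
    rcases h.meet 0 j (by omega) hj y hyE hyj with ⟨h1, h2⟩ | ⟨_, _, h2⟩
    · rw [h1, zero_add, hye] at h2
      apply hd0
      linear_combination -2 * h2 + 2 * hd
    · rw [hye] at h2
      apply hd0
      linear_combination 2 * h2
  -- The contribution of all other edges is continuous at the midpoint, so near it `g` differs from
  -- its value there by less than `π / 2`; between two such points it changes by less than `π`.
  set g : ℂ → ℝ := fun z => ∑ i ∈ (Finset.range m).erase 0, edgeAngle f z i with hg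
  have hgc : ContinuousAt g y := tendsto_finsetSum _ fun i hi =>
    continuousAt_edgeAngle (hyj i (Finset.mem_of_mem_erase hi) (Finset.ne_of_mem_erase hi))
  have hsplit : ∀ z, totalAngle f m z = g z + edgeAngle f z 0 := fun z => by
    rw [totalAngle, hg, Finset.sum_erase_add _ _ (by simp; omega)]
  have hball : ∀ᶠ z in 𝓝 y, z ∈ Metric.ball y r ∧
      (∀ j ∈ Finset.range m, j ≠ 0 → z ∉ edge f j) ∧ |g z - g y| < Real.pi / 2 := by
    have hb : ∀ᶠ z in 𝓝 y, z ∈ Metric.ball y r := Metric.ball_mem_nhds y hr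
    have hfar : ∀ᶠ z in 𝓝 y, ∀ j ∈ Finset.range m, j ≠ 0 → z ∉ edge f j := by
      refine (Filter.eventually_all_finset _).2 fun j hj => ?_
      by_cases hj0 : j = 0
      · simp [hj0]
      · filter_upwards [(isCompact_edge f j).isClosed.isOpen_compl.mem_nhds (hyj j hj hj0)]
          with z hz _ using hz
    refine hb.and (hfar.and ?_)
    have h0 : Tendsto (fun z => |g z - g y|) (𝓝 y) (𝓝 |g y - g y|) := (hgc.sub_const (g y)).abs
    simp only [sub_self, abs_zero] at h0
    exact h0.eventually_lt_const (by positivity)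
  have hline : ∀ c : ℂ, Tendsto (fun e : ℝ => y + e * c) (𝓝[>] 0) (𝓝 y) := fun c => by
    have : Continuous (fun e : ℝ => y + e * c) := by fun_prop
    simpa using (this.tendsto 0).mono_left nhdsWithin_le_nhds
  have hpos : ∀ᶠ e : ℝ in 𝓝[>] 0, 0 < e := self_mem_nhdsWithin
  have hsmall : ∀ᶠ e : ℝ in 𝓝[>] 0, e < 1 / 2 :=
    nhdsWithin_le_nhds (gt_mem_nhds (by norm_num))
  -- The two test points are `y ± e * (I * d)`. Since `e < 1 / 2`, they see the first edge under an
  -- obtuse angle, with opposite signs, so the contribution of this edge changes by at least `π`.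
  obtain ⟨e, ⟨h1b, h1o, h1g⟩, ⟨h2b, h2o, h2g⟩, he, he2⟩ := ((hline (I * d)).eventually hball).and
    (((hline (-(I * d))).eventually hball).and (hpos.and hsmall)) |>.exists
  have hquot : ∀ t : ℝ, (f 1 - (y + t * (I * d))) / (f 0 - (y + t * (I * d)))
      = (((t ^ 2 - 1 / 4) / (1 / 4 + t ^ 2) : ℝ) : ℂ) + ((t / (1 / 4 + t ^ 2) : ℝ) : ℂ) * I := by
    intro t
    have hn1 : (1 / 4 + t ^ 2 : ℝ) ≠ 0 := by positivity
    have hn2 : (1 / 4 + t ^ 2 : ℂ) ≠ 0 := by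
      have := ofReal_ne_zero.2 hn1
      push_cast at this
      exact this
    have hf1 : f 1 = f 0 + d := by rw [hd]; ring
    have hfac : (1 / 4 + t ^ 2 : ℂ) = (1 / 2 + t * I) * (1 / 2 - t * I) := by
      linear_combination (t : ℂ) ^ 2 * I_sq
    have hden : f 0 - (y + t * (I * d)) = -(1 / 2 + t * I) * d := by rw [hye]; ring
    have hn3 : (1 / 2 + t * I : ℂ) ≠ 0 := fun h0 => hn2 (by rw [hfac, h0, zero_mul])
    rw [hden, div_eq_iff (mul_ne_zero (neg_ne_zero.2 hn3) hd0), hye, hf1]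
    push_cast
    have hA := div_mul_cancel₀ ((t : ℂ) ^ 2 - 1 / 4) hn2
    have hB := div_mul_cancel₀ (t : ℂ) hn2
    apply mul_right_cancel₀ hn2
    linear_combination d * t ^ 2 * I_sq + (1 / 2 + t * I) * d * hA
      + I * (1 / 2 + t * I) * d * hB
  have hre : ∀ t : ℝ, ((f 1 - (y + t * (I * d))) / (f 0 - (y + t * (I * d)))).re
      = (t ^ 2 - 1 / 4) / (1 / 4 + t ^ 2) := fun t => by rw [hquot]; simp [-ofReal_div]
  have him : ∀ t : ℝ, ((f 1 - (y + t * (I * d))) / (f 0 - (y + t * (I * d)))).im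
      = t / (1 / 4 + t ^ 2) := fun t => by rw [hquot]; simp [-ofReal_div]
  have hneg : ∀ t : ℝ, t ^ 2 = e ^ 2 → (t ^ 2 - 1 / 4) / (1 / 4 + t ^ 2) < 0 := fun t ht => by
    apply div_neg_of_neg_of_pos _ (by positivity)
    rw [ht]
    nlinarith
  have hoff : ∀ t : ℝ, t ≠ 0 → y + t * (I * d) ∉ edge f 0 := by
    rintro t ht ⟨u, v, -, -, huv, hz⟩
    have hz' : (u : ℂ) * f 0 + v * f 1 = y + t * (I * d) := by simpa using hz
    have hu : (u : ℂ) = 1 - v := by rw [← ofReal_one, ← huv]; push_cast; ring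
    have h5 : (v - 1 / 2 : ℂ) = t * I := by
      apply mul_right_cancel₀ hd0
      rw [hu, hye] at hz'
      linear_combination hz' - v * hd
    have := congrArg Complex.im h5
    simp at this
    exact ht this.symm
  rw [show (y + e * -(I * d) : ℂ) = y + ((-e : ℝ) : ℂ) * (I * d) by push_cast; ring] at h2b h2o h2g
  have hcar : ∀ z, z ∉ edge f 0 → (∀ j ∈ Finset.range m, j ≠ 0 → z ∉ edge f j) →
      z ∉ carrier f m := by
    rintro z h0 hz ⟨j, hj, hzj⟩
    rcases eq_or_ne j 0 with rfl | hj0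
    exacts [h0 hzj, hz j (Finset.mem_range.2 hj) hj0 hzj]
  refine ⟨_, h1b, _, h2b, hcar _ (hoff e he.ne') h1o, hcar _ (hoff (-e) (neg_ne_zero.2 he.ne')) h2o,
    fun heq => ?_⟩
  rw [hsplit, hsplit] at heq
  have h5 : Real.pi / 2 ≤ edgeAngle f (y + e * (I * d)) 0 := by
    by_contra! hlt
    rw [edgeAngle, arg_lt_pi_div_two_iff] at hlt
    rcases hlt with h6 | h6 | h6
    · rw [hre] at h6
      exact lt_asymm h6 (hneg e rfl)
    · rw [him] at h6
      exact lt_asymm h6 (by positivity)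
    · have := him e
      rw [h6] at this
      exact (div_pos he (by positivity : 0 < 1 / 4 + e ^ 2)).ne this
  have h6 : edgeAngle f (y + ((-e : ℝ) : ℂ) * (I * d)) 0 ≤ -(Real.pi / 2) := by
    by_contra! hlt
    rw [edgeAngle, neg_pi_div_two_lt_arg_iff] at hlt
    rcases hlt with h6 | h6
    · rw [hre] at h6
      exact lt_asymm h6 (hneg (-e) (by ring))
    · rw [him] at h6
      exact absurd h6 (not_le.2 (div_neg_of_neg_of_pos (by linarith) (by positivity)))
  have h7 := abs_lt.1 h1g
  have h8 := abs_lt.1 h2g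
  linarith [h7.1, h8.2]

/-! ### Coordinates with respect to two vectors -/

/-- The determinant of two vectors of the plane. -/
def cross (a b : ℂ) : ℝ := a.re * b.im - a.im * b.re

@[simp] theorem cross_self (a : ℂ) : cross a a = 0 := by simp [cross]; ring

theorem cross_add_left (a b c : ℂ) : cross (a + b) c = cross a c + cross b c := by
  simp [cross]; ring

theorem cross_add_right (a b c : ℂ) : cross a (b + c) = cross a b + cross a c := by
  simp [cross]; ring

theorem cross_smul_left (r : ℝ) (a b : ℂ) : cross (r • a) b = r * cross a b := by
  simp [cross]; ring

theorem cross_smul_right (r : ℝ) (a b : ℂ) : cross a (r • b) = r * cross a b := by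
  simp [cross]; ring

/-- The coefficient of `a` in the expansion of `z` in the basis `a`, `b`. -/
noncomputable def coordLeft (a b z : ℂ) : ℝ := cross z b / cross a b

/-- The coefficient of `b` in the expansion of `z` in the basis `a`, `b`. -/
noncomputable def coordRight (a b z : ℂ) : ℝ := cross a z / cross a b

section coord

variable {a b : ℂ}

theorem coord_decomp (h : cross a b ≠ 0) (z : ℂ) :
    z = coordLeft a b z • a + coordRight a b z • b := by
  have h1 : cross a b • z = cross z b • a + cross a z • b := by
    apply Complex.ext <;> simp [cross] <;> ring
  rw [coordLeft, coordRight, div_eq_inv_mul, div_eq_inv_mul, mul_smul, mul_smul, ← smul_add, ← h1,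
    smul_smul, inv_mul_cancel₀ h, one_smul]

theorem coordLeft_comb (h : cross a b ≠ 0) (s t : ℝ) : coordLeft a b (s • a + t • b) = s := by
  rw [coordLeft, cross_add_left, cross_smul_left, cross_smul_left, cross_self]
  field_simp
  ring

theorem coordRight_comb (h : cross a b ≠ 0) (s t : ℝ) : coordRight a b (s • a + t • b) = t := by
  rw [coordRight, cross_add_right, cross_smul_right, cross_smul_right, cross_self]
  field_simp
  ring

theorem coordLeft_add (z w : ℂ) : coordLeft a b (z + w) = coordLeft a b z + coordLeft a b w := by
  simp [coordLeft, cross_add_left, add_div]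

theorem coordRight_add (z w : ℂ) :
    coordRight a b (z + w) = coordRight a b z + coordRight a b w := by
  simp [coordRight, cross_add_right, add_div]

theorem coordLeft_smul (r : ℝ) (z : ℂ) : coordLeft a b (r • z) = r * coordLeft a b z := by
  simp only [coordLeft, cross_smul_left, mul_div_assoc]

theorem coordRight_smul (r : ℝ) (z : ℂ) : coordRight a b (r • z) = r * coordRight a b z := by
  simp only [coordRight, cross_smul_right, mul_div_assoc]

end coord

/-! ### A chain locally has two sides -/

/-- Inside the ball of radius `r` around `y`, the complement of `K` is the union of the connected
sets `A` and `B`, and every point of `K` is adherent to both of them. -/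
structure TwoSided (K : Set ℂ) (y : ℂ) (r : ℝ) (A B : Set ℂ) : Prop where
  pos : 0 < r
  left : IsPreconnected A
  right : IsPreconnected B
  union : A ∪ B = Metric.ball y r \ K
  closure_left : K ∩ Metric.ball y r ⊆ closure A
  closure_right : K ∩ Metric.ball y r ⊆ closure B

theorem mem_closure_of_ray {S U : Set ℂ} (hU : IsOpen U) {y e : ℂ} (hy : y ∈ U)
    (h : ∀ ε : ℝ, 0 < ε → y + ε • e ∈ S) : y ∈ closure (U ∩ S) := by
  have hc : Continuous fun ε : ℝ => y + ε • e := by fun_prop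
  have h1 : Tendsto (fun ε : ℝ => y + ε • e) (𝓝[>] 0) (𝓝 y) := by
    simpa using (hc.tendsto 0).mono_left nhdsWithin_le_nhds
  refine mem_closure_of_tendsto h1 ?_
  filter_upwards [h1.eventually (hU.mem_nhds hy), self_mem_nhdsWithin] with ε h2 h3
  exact ⟨h2, h ε h3⟩

/-- Inside a ball that does not reach beyond `p`, a segment from the centre to `p` is
indistinguishable from a ray. -/
theorem mem_segment_iff_of_mem_ball {y p z : ℂ} {r : ℝ} (hr : r ≤ dist p y)
    (hz : z ∈ Metric.ball y r) : z ∈ segment ℝ y p ↔ ∃ c : ℝ, 0 ≤ c ∧ z = y + c • (p - y) := by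
  rw [segment_eq_image']
  constructor
  · rintro ⟨c, hc, rfl⟩
    exact ⟨c, hc.1, rfl⟩
  · rintro ⟨c, hc, rfl⟩
    refine ⟨c, ⟨hc, ?_⟩, rfl⟩
    by_contra! hlt
    rw [Metric.mem_ball, dist_eq_norm, add_sub_cancel_left, norm_smul, Real.norm_eq_abs,
      abs_of_nonneg hc] at hz
    rw [dist_eq_norm] at hr
    nlinarith [norm_nonneg (p - y)]

/-- The convex sector at `y` spanned by `a` and `b`. -/
def sector (y a b : ℂ) : Set ℂ := {z | 0 < coordLeft a b (z - y) ∧ 0 < coordRight a b (z - y)}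

/-- The complement of the closed convex sector at `y` spanned by `a` and `b`. -/
def coSector (y a b : ℂ) : Set ℂ := {z | coordLeft a b (z - y) < 0 ∨ coordRight a b (z - y) < 0}

theorem convex_coordLeft {I : Set ℝ} (hI : Convex ℝ I) (y a b : ℂ) :
    Convex ℝ {z | coordLeft a b (z - y) ∈ I} := by
  intro z hz w hw s t hs ht hst
  have : s • z + t • w - y = s • (z - y) + t • (w - y) := by
    rw [smul_sub, smul_sub, sub_add_sub_comm, ← add_smul, hst, one_smul]
  simp only [mem_ofPred_eq, this, coordLeft_add, coordLeft_smul]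
  exact hI hz hw hs ht hst

theorem convex_coordRight {I : Set ℝ} (hI : Convex ℝ I) (y a b : ℂ) :
    Convex ℝ {z | coordRight a b (z - y) ∈ I} := by
  intro z hz w hw s t hs ht hst
  have : s • z + t • w - y = s • (z - y) + t • (w - y) := by
    rw [smul_sub, smul_sub, sub_add_sub_comm, ← add_smul, hst, one_smul]
  simp only [mem_ofPred_eq, this, coordRight_add, coordRight_smul]
  exact hI hz hw hs ht hst

theorem convex_sector (y a b : ℂ) : Convex ℝ (sector y a b) :=
  (convex_coordLeft (convex_Ioi 0) y a b).inter (convex_coordRight (convex_Ioi 0) y a b)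

/-- One side is a convex sector. The other is the union of two convex half-discs with a common point
in the opposite sector. Every point of the chain in the ball is a limit along a suitable direction
into either side. -/
theorem twoSided_corner {K : Set ℂ} {y p q : ℂ} {r : ℝ} (hr : 0 < r) (hp : r ≤ dist p y)
    (hq : r ≤ dist q y)
    (hK : ∀ z ∈ Metric.ball y r, z ∈ K ↔ z ∈ segment ℝ y p ∨ z ∈ segment ℝ y q)
    (hD : cross (p - y) (q - y) ≠ 0) :
    TwoSided K y r (Metric.ball y r ∩ sector y (p - y) (q - y))
      (Metric.ball y r ∩ coSector y (p - y) (q - y)) := by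
  set a := p - y with ha
  set b := q - y with hb
  have hK' : ∀ z ∈ Metric.ball y r, z ∈ K ↔
      (0 ≤ coordLeft a b (z - y) ∧ coordRight a b (z - y) = 0) ∨
      (coordLeft a b (z - y) = 0 ∧ 0 ≤ coordRight a b (z - y)) := by
    intro z hz
    rw [hK z hz, mem_segment_iff_of_mem_ball hp hz, mem_segment_iff_of_mem_ball hq hz]
    have hdec := coord_decomp hD (z - y)
    refine or_congr ⟨?_, ?_⟩ ⟨?_, ?_⟩
    · rintro ⟨c, hc, rfl⟩
      have h1 := coordLeft_comb hD c 0
      have h2 := coordRight_comb hD c 0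
      rw [zero_smul, add_zero] at h1 h2
      rw [add_sub_cancel_left]
      exact ⟨hc.trans_eq h1.symm, h2⟩
    · rintro ⟨h1, h2⟩
      rw [h2, zero_smul, add_zero] at hdec
      exact ⟨_, h1, by rw [← ha, ← hdec]; ring⟩
    · rintro ⟨c, hc, rfl⟩
      have h1 := coordLeft_comb hD 0 c
      have h2 := coordRight_comb hD 0 c
      rw [zero_smul, zero_add] at h1 h2
      rw [add_sub_cancel_left]
      exact ⟨h1, hc.trans_eq h2.symm⟩
    · rintro ⟨h1, h2⟩
      rw [h1, zero_smul, zero_add] at hdec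
      exact ⟨_, h2, by rw [← hb, ← hdec]; ring⟩
  have hopen := Metric.isOpen_ball (x := y) (ε := r)
  have hcL : ∀ (z e : ℂ) (ε : ℝ), coordLeft a b (z + ε • e - y)
      = coordLeft a b (z - y) + ε * coordLeft a b e := fun z e ε => by
    rw [add_sub_right_comm, coordLeft_add, coordLeft_smul]
  have hcR : ∀ (z e : ℂ) (ε : ℝ), coordRight a b (z + ε • e - y)
      = coordRight a b (z - y) + ε * coordRight a b e := fun z e ε => by
    rw [add_sub_right_comm, coordRight_add, coordRight_smul]
  have e1 := coordLeft_comb hD 1 1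
  have e2 := coordRight_comb hD 1 1
  have e3 := coordLeft_comb hD (-1) 0
  have e4 := coordRight_comb hD (-1) 0
  have e5 := coordLeft_comb hD 0 (-1)
  have e6 := coordRight_comb hD 0 (-1)
  have e7 := coordLeft_comb hD (-1) (-1)
  have e8 := coordRight_comb hD (-1) (-1)
  refine ⟨hr, ((convex_ball y r).inter (convex_sector y a b)).isPreconnected, ?_, ?_, ?_, ?_⟩
  · have hBeq : Metric.ball y r ∩ coSector y a b
        = (Metric.ball y r ∩ {z | coordLeft a b (z - y) ∈ Iio 0}) ∪
          (Metric.ball y r ∩ {z | coordRight a b (z - y) ∈ Iio 0}) := by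
      rw [← inter_union_distrib_left]
      rfl
    obtain ⟨z, hz⟩ : (Metric.ball y r ∩ {z | coordLeft a b (z - y) < 0 ∧
        coordRight a b (z - y) < 0}).Nonempty := by
      rw [← closure_nonempty_iff]
      refine ⟨y, mem_closure_of_ray hopen (e := (-1 : ℝ) • a + (-1 : ℝ) • b)
        (Metric.mem_ball_self hr) fun ε hε => ?_⟩
      rw [mem_ofPred_eq, hcL, hcR, e7, e8]
      simp [coordLeft, coordRight, cross, hε]
    rw [hBeq]
    exact IsPreconnected.union z ⟨hz.1, hz.2.1⟩ ⟨hz.1, hz.2.2⟩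
      ((convex_ball y r).inter (convex_coordLeft (convex_Iio 0) y a b)).isPreconnected
      ((convex_ball y r).inter (convex_coordRight (convex_Iio 0) y a b)).isPreconnected
  · rw [← inter_union_distrib_left]
    ext z
    refine and_congr_right fun hz => ?_
    rw [hK' z hz]
    simp only [sector, coSector, mem_union, mem_ofPred_eq]
    grind
  · rintro z ⟨hzK, hz⟩
    refine mem_closure_of_ray hopen (e := (1 : ℝ) • a + (1 : ℝ) • b) hz fun ε hε => ?_
    rw [sector, mem_ofPred_eq, hcL, hcR, e1, e2]
    rcases (hK' z hz).1 hzK with ⟨h1, h2⟩ | ⟨h1, h2⟩ <;> constructor <;> linarith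
  · rintro z ⟨hzK, hz⟩
    rcases (hK' z hz).1 hzK with ⟨h1, h2⟩ | ⟨h1, h2⟩
    · refine mem_closure_of_ray hopen (e := (0 : ℝ) • a + (-1 : ℝ) • b) hz fun ε hε => Or.inr ?_
      rw [hcR, e6, h2]
      linarith
    · refine mem_closure_of_ray hopen (e := (-1 : ℝ) • a + (0 : ℝ) • b) hz fun ε hε => Or.inl ?_
      rw [hcL, e3, h1]
      linarith

theorem exists_smul_eq_of_cross_eq_zero {a b : ℂ} (ha : a ≠ 0) (h : cross a b = 0) :
    ∃ c : ℝ, b = c • a := by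
  have hn : 0 < normSq a := normSq_pos.2 ha
  refine ⟨(a.re * b.re + a.im * b.im) / normSq a, ?_⟩
  have h1 : normSq a • b = (a.re * b.re + a.im * b.im) • a := by
    unfold cross at h
    apply Complex.ext <;> simp [normSq_apply]
    · linear_combination -a.im * h
    · linear_combination a.re * h
  rw [div_eq_inv_mul, mul_smul, ← h1, smul_smul, inv_mul_cancel₀ hn.ne', one_smul]

theorem twoSided_straight {K : Set ℂ} {y p q : ℂ} {r : ℝ} (hr : 0 < r) (hp : r ≤ dist p y)
    (hq : r ≤ dist q y)
    (hK : ∀ z ∈ Metric.ball y r, z ∈ K ↔ z ∈ segment ℝ y p ∨ z ∈ segment ℝ y q)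
    {c : ℝ} (hc : c < 0) (hD : q - y = c • (p - y)) :
    TwoSided K y r (Metric.ball y r ∩ {z | 0 < cross (p - y) (z - y)})
      (Metric.ball y r ∩ {z | cross (p - y) (z - y) < 0}) := by
  set a := p - y with ha
  have ha0 : a ≠ 0 := by
    intro h0
    rw [dist_eq_norm, ← ha, h0, norm_zero] at hp
    linarith
  have hK' : ∀ z ∈ Metric.ball y r, z ∈ K ↔ cross a (z - y) = 0 := by
    intro z hz
    rw [hK z hz, mem_segment_iff_of_mem_ball hp hz, mem_segment_iff_of_mem_ball hq hz, hD]
    constructor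
    · rintro (⟨t, -, rfl⟩ | ⟨t, -, rfl⟩) <;>
      simp only [add_sub_cancel_left, cross_smul_right, ← ha, cross_self, mul_zero]
    · intro h0
      obtain ⟨t, ht⟩ := exists_smul_eq_of_cross_eq_zero ha0 h0
      rcases le_total 0 t with h | h
      · exact Or.inl ⟨t, h, by rw [← ha, ← ht]; ring⟩
      · refine Or.inr ⟨t / c, div_nonneg_of_nonpos h hc.le, ?_⟩
        rw [smul_smul, div_mul_cancel₀ _ hc.ne, ← ht]
        ring
  have hconv : ∀ I : Set ℝ, Convex ℝ I → Convex ℝ {z | cross a (z - y) ∈ I} := by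
    intro I hI z hz w hw s t hs ht hst
    have : s • z + t • w - y = s • (z - y) + t • (w - y) := by
      rw [smul_sub, smul_sub, sub_add_sub_comm, ← add_smul, hst, one_smul]
    simp only [mem_ofPred_eq, this, cross_add_right, cross_smul_right]
    exact hI hz hw hs ht hst
  have hopen := Metric.isOpen_ball (x := y) (ε := r)
  have hI : cross a (I * a) = normSq a := by simp [cross, normSq_apply]
  have hn : 0 < normSq a := normSq_pos.2 ha0
  refine ⟨hr, ((convex_ball y r).inter (hconv _ (convex_Ioi 0))).isPreconnected,
    ((convex_ball y r).inter (hconv _ (convex_Iio 0))).isPreconnected, ?_, ?_, ?_⟩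
  · rw [← inter_union_distrib_left]
    ext z
    refine and_congr_right fun hz => ?_
    rw [hK' z hz]
    simp only [mem_union, mem_ofPred_eq]
    exact ⟨fun h => h.elim ne_of_gt ne_of_lt, fun h => (lt_or_gt_of_ne h).symm⟩
  · rintro z ⟨hzK, hz⟩
    refine mem_closure_of_ray hopen (e := I * a) hz fun ε hε => ?_
    rw [mem_ofPred_eq, add_sub_right_comm, cross_add_right, (hK' z hz).1 hzK, cross_smul_right, hI,
      zero_add]
    positivity
  · rintro z ⟨hzK, hz⟩
    refine mem_closure_of_ray hopen (e := (-1 : ℝ) • (I * a)) hz fun ε hε => ?_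
    rw [mem_ofPred_eq, add_sub_right_comm, cross_add_right, (hK' z hz).1 hzK, cross_smul_right,
      cross_smul_right, hI, zero_add]
    nlinarith

/-- With `c > 0` the segments would leave `y` in the same direction and overlap beyond `y`. -/
theorem neg_of_segment_inter_subset {y p q : ℂ} (hp : p ≠ y) (hq : q ≠ y)
    (hpq : segment ℝ y p ∩ segment ℝ y q ⊆ {y}) {c : ℝ} (hc : q - y = c • (p - y)) : c < 0 := by
  have ha0 : p - y ≠ 0 := sub_ne_zero.2 hp
  have hc0 : c ≠ 0 := by
    rintro rfl
    rw [zero_smul] at hc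
    exact hq (sub_eq_zero.1 hc)
  by_contra! hcn
  have hcpos : 0 < c := lt_of_le_of_ne hcn hc0.symm
  have h1 : y + (min 1 c) • (p - y) ∈ segment ℝ y p := by
    rw [segment_eq_image']
    exact ⟨min 1 c, ⟨by positivity, min_le_left _ _⟩, rfl⟩
  have h2 : y + (min 1 c) • (p - y) ∈ segment ℝ y q := by
    rw [segment_eq_image', hc]
    refine ⟨min 1 c / c, ⟨by positivity, (div_le_one hcpos).2 (min_le_right _ _)⟩, ?_⟩
    simp only [smul_smul]
    rw [div_mul_cancel₀ _ hc0]
  have h3 := hpq ⟨h1, h2⟩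
  rw [mem_singleton_iff, add_eq_left, smul_eq_zero] at h3
  rcases h3 with h3 | h3
  · have : 0 < min 1 c := by positivity
    exact this.ne' h3
  · exact ha0 h3

theorem exists_twoSided {K : Set ℂ} {y p q : ℂ} {r : ℝ} (hr : 0 < r) (hp : r ≤ dist p y)
    (hq : r ≤ dist q y)
    (hK : ∀ z ∈ Metric.ball y r, z ∈ K ↔ z ∈ segment ℝ y p ∨ z ∈ segment ℝ y q)
    (hpq : segment ℝ y p ∩ segment ℝ y q ⊆ {y}) : ∃ A B, TwoSided K y r A B := by
  by_cases hD : cross (p - y) (q - y) = 0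
  · have hp0 : p ≠ y := dist_pos.1 (hr.trans_le hp)
    have hq0 : q ≠ y := dist_pos.1 (hr.trans_le hq)
    obtain ⟨c, hc⟩ := exists_smul_eq_of_cross_eq_zero (sub_ne_zero.2 hp0) hD
    exact ⟨_, _, twoSided_straight hr hp hq hK (neg_of_segment_inter_subset hp0 hq0 hpq hc) hc⟩
  · exact ⟨_, _, twoSided_corner hr hp hq hK hD⟩

theorem exists_ball_disjoint_edges (f : ℕ → ℂ) (J : Finset ℕ) {y : ℂ}
    (h : ∀ j ∈ J, y ∉ edge f j) :
    ∃ r > 0, ∀ z ∈ Metric.ball y r, ∀ j ∈ J, z ∉ edge f j := by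
  have : ∀ᶠ z in 𝓝 y, ∀ j ∈ J, z ∉ edge f j :=
    (Filter.eventually_all_finset _).2 fun j hj =>
      (isCompact_edge f j).isClosed.isOpen_compl.mem_nhds (h j hj)
  exact Metric.eventually_nhds_iff_ball.1 this

theorem segment_eq_union {a b y : ℂ} (hy : y ∈ segment ℝ a b) :
    segment ℝ a b = segment ℝ y a ∪ segment ℝ y b := by
  apply Subset.antisymm
  · intro z hz
    have hzb : Wbtw ℝ a z b := mem_segment_iff_wbtw.1 hz
    obtain ⟨s, hs, rfl⟩ := hzb
    obtain ⟨t, ht, rfl⟩ := mem_segment_iff_wbtw.1 hy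
    have := wbtw_or_wbtw_smul_vadd_of_nonneg a (b -ᵥ a) hs.1 ht.1
    simp only [← AffineMap.lineMap_apply] at this
    rcases this with h | h
    · exact Or.inl (mem_segment_iff_wbtw.2 h.symm)
    · exact Or.inr (mem_segment_iff_wbtw.2 ((mem_segment_iff_wbtw.1 hz).trans_left_right h))
  · have hc := convex_segment (𝕜 := ℝ) a b
    exact union_subset (hc.segment_subset hy (left_mem_segment ℝ _ _))
      (hc.segment_subset hy (right_mem_segment ℝ _ _))

namespace IsSimpleChain

variable {f : ℕ → ℂ} {m : ℕ}

theorem ne_of_lt (h : IsSimpleChain f m) {i j : ℕ} (hij : i < j) (hj : j < m) : f i ≠ f j :=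
  fun he => hij.ne (h.inj i (by omega) j hj he)

theorem edge_last (h : IsSimpleChain f m) : edge f (m - 1) = segment ℝ (f 0) (f (m - 1)) := by
  have h3 := h.three_le
  rw [edge, Nat.sub_add_cancel (by omega), h.zero_eq, segment_symm]

/-- Near the vertex `f 0` the chain consists of the two edges at this vertex. -/
theorem exists_ball_vertex (h : IsSimpleChain f m) :
    ∃ r > 0, r ≤ dist (f 1) (f 0) ∧ r ≤ dist (f (m - 1)) (f 0) ∧
      ∀ z ∈ Metric.ball (f 0) r, z ∈ carrier f m ↔
        z ∈ segment ℝ (f 0) (f 1) ∨ z ∈ segment ℝ (f 0) (f (m - 1)) := by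
  have h3 := h.three_le
  obtain ⟨r, hr, hb⟩ := exists_ball_disjoint_edges f (Finset.Ico 1 (m - 1)) (y := f 0) (by
    intro j hj hm
    rw [Finset.mem_Ico] at hj
    have := h.vertex_mem_edge (by omega) (by omega) hm
    omega)
  have h1 : 0 < dist (f 1) (f 0) := dist_pos.2 (h.ne_of_lt one_pos (by omega)).symm
  have h2 : 0 < dist (f (m - 1)) (f 0) := dist_pos.2 (h.ne_of_lt (by omega) (by omega)).symm
  refine ⟨min r (min (dist (f 1) (f 0)) (dist (f (m - 1)) (f 0))), by positivity,
    (min_le_right _ _).trans (min_le_left _ _), (min_le_right _ _).trans (min_le_right _ _),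
    fun z hz => ?_⟩
  have hz' := Metric.ball_subset_ball (min_le_left _ _) hz
  constructor
  · rintro ⟨j, hj, hzj⟩
    by_cases hj0 : j = 0
    · subst hj0
      exact Or.inl hzj
    · by_cases hjm : j = m - 1
      · subst hjm
        rw [h.edge_last] at hzj
        exact Or.inr hzj
      · exact absurd hzj (hb z hz' j (Finset.mem_Ico.2 ⟨by omega, by omega⟩))
  · rintro (hz | hz)
    · exact ⟨0, by omega, hz⟩
    · rw [← h.edge_last] at hz
      exact ⟨m - 1, by omega, hz⟩

theorem segment_inter_subset (h : IsSimpleChain f m) :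
    segment ℝ (f 0) (f 1) ∩ segment ℝ (f 0) (f (m - 1)) ⊆ {f 0} := by
  have h3 := h.three_le
  rintro y ⟨h1, h2⟩
  rw [← h.edge_last] at h2
  rcases h.meet 0 (m - 1) (by omega) (by omega) y h1 h2 with ⟨h4, _⟩ | ⟨_, _, h4⟩
  · omega
  · exact h4

/-- The half-open first edges of the cyclic shifts cover the chain, so omitting `f 1` loses nothing.
At an interior point of the edge, the two local arms run towards its endpoints. -/
theorem exists_twoSided_zero (h : IsSimpleChain f m) {y : ℂ} (hy : y ∈ edge f 0) (hy1 : y ≠ f 1) :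
    ∃ r A B, TwoSided (carrier f m) y r A B := by
  have h3 := h.three_le
  by_cases hy0 : y = f 0
  · subst hy0
    obtain ⟨r, hr, h1, h2, hK⟩ := h.exists_ball_vertex
    exact ⟨r, exists_twoSided hr h1 h2 hK h.segment_inter_subset⟩
  obtain ⟨r, hr, hb⟩ := exists_ball_disjoint_edges f (Finset.Ico 1 m) (y := y) (by
    intro j hj hm
    rw [Finset.mem_Ico] at hj
    rcases h.meet 0 j (by omega) hj.2 y hy hm with ⟨h4, h5⟩ | ⟨_, _, h4⟩
    · rw [h4] at h5
      exact hy1 h5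
    · exact hy0 h4)
  have h1 : 0 < dist (f 1) y := dist_pos.2 (Ne.symm hy1)
  have h2 : 0 < dist (f 0) y := dist_pos.2 (Ne.symm hy0)
  have hinter : segment ℝ y (f 1) ∩ segment ℝ y (f 0) ⊆ {y} := by
    rintro z ⟨hz1, hz0⟩
    have hw : Wbtw ℝ (f 0) y (f 1) := mem_segment_iff_wbtw.1 hy
    have hw1 : Wbtw ℝ y z (f 1) := mem_segment_iff_wbtw.1 hz1
    have hw0 : Wbtw ℝ y z (f 0) := mem_segment_iff_wbtw.1 hz0
    exact ((hw.trans_right_left hw1).swap_right_iff.1 hw0.symm).symm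
  refine ⟨min r (min (dist (f 1) y) (dist (f 0) y)), exists_twoSided (p := f 1) (q := f 0)
    (by positivity) ((min_le_right _ _).trans (min_le_left _ _))
    ((min_le_right _ _).trans (min_le_right _ _)) (fun z hz => ?_) hinter⟩
  have hz' := Metric.ball_subset_ball (min_le_left _ _) hz
  have : z ∈ carrier f m ↔ z ∈ segment ℝ (f 0) (f 1) := by
    constructor
    · rintro ⟨j, hj, hzj⟩
      by_cases hj0 : j = 0
      · subst hj0
        exact hzj
      · exact absurd hzj (hb z hz' j (Finset.mem_Ico.2 ⟨by omega, hj⟩))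
    · exact fun hz => ⟨0, by omega, hz⟩
  rw [this, segment_eq_union hy, mem_union, or_comm]

theorem exists_twoSided (h : IsSimpleChain f m) {y : ℂ} (hy : y ∈ carrier f m) :
    ∃ r A B, TwoSided (carrier f m) y r A B := by
  obtain ⟨i, hi, hyi⟩ := hy
  by_cases h1 : y = f (i + 1)
  · rw [← h.carrier_shift (i + 1)]
    have hs := h.shift (i + 1)
    refine hs.exists_twoSided_zero (y := y) ?_ ?_
    · rw [h1]
      simpa using left_mem_edge (fun k => f (k + (i + 1))) 0
    · have := hs.ne_of_lt (i := 0) (j := 1) one_pos (by have := h.three_le; omega)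
      rw [h1]
      simpa using this
  · rw [← h.carrier_shift i]
    refine (h.shift i).exists_twoSided_zero (y := y) ?_ ?_
    · simpa [edge, add_comm] using hyi
    · simpa [add_comm] using h1

/-! ### Enclosed points have nonzero total angle -/

/-- Every component of the complement of a simple chain is adherent to the whole chain. -/
theorem carrier_subset_closure (h : IsSimpleChain f m) {x : ℂ} (hx : x ∉ carrier f m) :
    carrier f m ⊆ closure (connectedComponentIn (carrier f m)ᶜ x) := by
  set K := carrier f m with hK
  set U := connectedComponentIn Kᶜ x with hU
  have hKo : IsOpen Kᶜ := (isCompact_carrier f m).isClosed.isOpen_compl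
  have hUo : IsOpen U := hKo.connectedComponentIn
  have hxU : x ∈ U := mem_connectedComponentIn hx
  have hUK : U ⊆ Kᶜ := connectedComponentIn_subset _ _
  have hK0 : f 0 ∈ K := ⟨0, by have := h.three_le; omega, left_mem_edge f 0⟩
  have hfr : frontier U ⊆ K := by
    intro y hy
    by_contra hyK
    have hyo : IsOpen (connectedComponentIn Kᶜ y) := hKo.connectedComponentIn
    obtain ⟨z, hz1, hz2⟩ := mem_closure_iff.1 (frontier_subset_closure hy) _ hyo
      (mem_connectedComponentIn hyK)
    have : U = connectedComponentIn Kᶜ y :=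
      (connectedComponentIn_eq hz2).trans (connectedComponentIn_eq hz1).symm
    have hyU : y ∈ U := this ▸ mem_connectedComponentIn hyK
    exact (hUo.frontier_eq ▸ hy).2 hyU
  have hne : (frontier U).Nonempty :=
    nonempty_frontier_iff.2 ⟨⟨x, hxU⟩, fun h0 => hUK (h0 ▸ mem_univ (f 0) : f 0 ∈ U) hK0⟩
  obtain ⟨y₀, hy₀⟩ := hne
  -- Relative openness of `K ∩ closure U` in `K`: a component coming close to `y` contains a whole
  -- local side, and that side is adherent to all of `K` near `y`.
  have hloc : ∀ y ∈ K, y ∈ closure U → y ∈ interior (closure U ∪ Kᶜ) := by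
    intro y hyK hyU
    obtain ⟨r, A, B, hT⟩ := h.exists_twoSided hyK
    rw [mem_interior]
    refine ⟨Metric.ball y r, ?_, Metric.isOpen_ball, Metric.mem_ball_self hT.pos⟩
    obtain ⟨z, hzb, hzU⟩ := mem_closure_iff.1 hyU _ Metric.isOpen_ball
      (Metric.mem_ball_self hT.pos)
    have hz : z ∈ A ∪ B := hT.union ▸ ⟨hzb, hUK hzU⟩
    have hABK : A ∪ B ⊆ Kᶜ := hT.union ▸ fun w hw => hw.2
    have hsub : ∀ S : Set ℂ, IsPreconnected S → S ⊆ Kᶜ → z ∈ S → S ⊆ U := by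
      intro S hS hSK hzS
      have := hS.subset_connectedComponentIn hzS hSK
      rwa [← connectedComponentIn_eq hzU] at this
    intro w hw
    by_cases hwK : w ∈ K
    · left
      rcases hz with hz | hz
      · exact closure_mono (hsub A hT.left (subset_union_left.trans hABK) hz)
          (hT.closure_left ⟨hwK, hw⟩)
      · exact closure_mono (hsub B hT.right (subset_union_right.trans hABK) hz)
          (hT.closure_right ⟨hwK, hw⟩)
    · exact Or.inr hwK
  intro y hyK
  by_contra hyU
  -- The chain is connected, so the nonempty, relatively clopen set `K ∩ closure U` is all of `K`.
  obtain ⟨z, hzK, hz1, hz2⟩ := isPreconnected_carrier f m _ (closure U)ᶜ isOpen_interior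
    isClosed_closure.isOpen_compl (fun z hz => by
      by_cases hzU : z ∈ closure U
      exacts [Or.inl (hloc z hz hzU), Or.inr hzU])
    ⟨y₀, hfr hy₀, hloc y₀ (hfr hy₀) (frontier_subset_closure hy₀)⟩ ⟨y, hyK, hyU⟩
  rcases interior_subset hz1 with h1 | h1
  exacts [hz2 h1, h1 hzK]

theorem _root_.PlaneChain.TwoSided.subset_component {K : Set ℂ} {y : ℂ} {r : ℝ} {A B : Set ℂ}
    (hT : TwoSided K y r A B) {x : ℂ} (hy : y ∈ closure (connectedComponentIn Kᶜ x)) :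
    A ⊆ connectedComponentIn Kᶜ x ∧ A.Nonempty ∨ B ⊆ connectedComponentIn Kᶜ x ∧ B.Nonempty := by
  obtain ⟨z, hzb, hzU⟩ := mem_closure_iff.1 hy _ Metric.isOpen_ball
    (Metric.mem_ball_self hT.pos)
  have hz : z ∈ A ∪ B := hT.union ▸ ⟨hzb, connectedComponentIn_subset _ _ hzU⟩
  have hABK : A ∪ B ⊆ Kᶜ := hT.union ▸ fun w hw => hw.2
  have hsub : ∀ S : Set ℂ, IsPreconnected S → S ⊆ Kᶜ → z ∈ S →
      S ⊆ connectedComponentIn Kᶜ x ∧ S.Nonempty := by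
    intro S hS hSK hzS
    have := hS.subset_connectedComponentIn hzS hSK
    rw [← connectedComponentIn_eq hzU] at this
    exact ⟨this, z, hzS⟩
  exact hz.imp (hsub A hT.left (subset_union_left.trans hABK))
    (hsub B hT.right (subset_union_right.trans hABK))

end IsSimpleChain

/-- A half-plane to the right of a disc containing `K` is connected, unbounded and misses `K`. -/
theorem exists_ray_disjoint {K : Set ℂ} (hK : IsCompact K) :
    ∃ x, x ∉ K ∧ ¬ Bornology.IsBounded (connectedComponentIn Kᶜ x) := by
  obtain ⟨R, hR⟩ := hK.isBounded.subset_closedBall 0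
  set H : Set ℂ := {z | R < z.re} with hH
  have hHK : H ⊆ Kᶜ := fun z hz hzK => by
    have h1 := hR hzK
    rw [mem_closedBall_zero_iff] at h1
    have h2 := re_le_norm z
    have h3 : R < z.re := hz
    linarith
  have hHp : IsPreconnected H := (convex_halfSpace_re_gt R).isPreconnected
  have hx : ((R + 1 : ℝ) : ℂ) ∈ H := by simp [hH, -ofReal_add]
  refine ⟨_, hHK hx, fun hb => ?_⟩
  obtain ⟨M, hM⟩ := (hb.subset (hHp.subset_connectedComponentIn hx hHK)).subset_closedBall 0
  have h1 : ((max R M + 1 : ℝ) : ℂ) ∈ H := by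
    simp only [hH, mem_ofPred_eq, ofReal_re]
    linarith [le_max_left R M]
  have h2 := hM h1
  rw [mem_closedBall_zero_iff] at h2
  have h3 := re_le_norm ((max R M + 1 : ℝ) : ℂ)
  rw [ofReal_re] at h3
  linarith [le_max_right R M]

namespace IsSimpleChain

variable {f : ℕ → ℂ} {m : ℕ}

/-- A point outside a simple chain is enclosed by it only if the total angle does not vanish. -/
theorem totalAngle_ne_zero (h : IsSimpleChain f m) {x : ℂ} (hx : x ∉ carrier f m)
    (hxe : x ∈ enclosed (carrier f m)) : totalAngle f m x ≠ 0 := by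
  intro h0
  have h3 := h.three_le
  obtain ⟨v, hv, hvb⟩ := exists_ray_disjoint (isCompact_carrier f m)
  set K := carrier f m with hK
  have hub : Bornology.IsBounded (connectedComponentIn Kᶜ x) := hxe.elim (fun h => absurd h hx)
    (fun h => h.2)
  have hmid : midpoint ℝ (f 0) (f 1) ∈ K := ⟨0, by omega, midpoint_mem_segment _ _⟩
  have hdisj : ∀ z, z ∈ connectedComponentIn Kᶜ x → z ∉ connectedComponentIn Kᶜ v := by
    intro z h1 h2
    rw [connectedComponentIn_eq h1, ← connectedComponentIn_eq h2] at hub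
    exact hvb hub
  obtain ⟨r, A, B, hT⟩ := h.exists_twoSided hmid
  obtain ⟨z₁, hz₁, z₂, hz₂, h1K, h2K, hne⟩ := h.exists_totalAngle_ne hT.pos
  -- The bounded component of `x` and the unbounded component of `v` each contain a local side, and
  -- not the same one because they are disjoint.
  have hzero : ∀ z ∈ A ∪ B, totalAngle f m z = 0 := by
    have hU : ∀ z ∈ connectedComponentIn Kᶜ x, totalAngle f m z = 0 := fun z hz => by
      rw [← h0]
      exact totalAngle_const h.zero_eq isPreconnected_connectedComponentIn
        (connectedComponentIn_subset _ _) hz (mem_connectedComponentIn hx)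
    have hV : ∀ z ∈ connectedComponentIn Kᶜ v, totalAngle f m z = 0 := fun z hz =>
      totalAngle_eq_zero h.zero_eq isPreconnected_connectedComponentIn
        (connectedComponentIn_subset _ _) hvb hz
    rcases hT.subset_component (h.carrier_subset_closure hx hmid) with ⟨h1, z, hz⟩ | ⟨h1, z, hz⟩ <;>
    rcases hT.subset_component (h.carrier_subset_closure hv hmid) with ⟨h2, -⟩ | ⟨h2, -⟩
    · exact absurd (h2 hz) (hdisj z (h1 hz))
    · exact fun z hz => hz.elim (fun hz => hU z (h1 hz)) (fun hz => hV z (h2 hz))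
    · exact fun z hz => hz.elim (fun hz => hV z (h2 hz)) (fun hz => hU z (h1 hz))
    · exact absurd (h2 hz) (hdisj z (h1 hz))
  rw [hT.union] at hzero
  exact hne ((hzero z₁ ⟨hz₁, h1K⟩).trans (hzero z₂ ⟨hz₂, h2K⟩).symm)

end IsSimpleChain

/-! ### Cutting along a diagonal -/

theorem carrier_add (f : ℕ → ℂ) (j l : ℕ) :
    carrier f (j + l) = carrier f j ∪ carrier (fun i => f (i + j)) l := by
  induction l with
  | zero => simp [carrier_zero]
  | succ l ih =>
    rw [← add_assoc, carrier_succ, carrier_succ, ih, union_assoc]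
    congr 2
    simp only [edge, show l + j = j + l by omega, show l + 1 + j = j + l + 1 by omega]

theorem totalAngle_add (f : ℕ → ℂ) (j l : ℕ) (z : ℂ) :
    totalAngle f (j + l) z = totalAngle f j z + totalAngle (fun i => f (i + j)) l z := by
  simp only [totalAngle, Finset.sum_range_add, edgeAngle]
  congr 1
  refine Finset.sum_congr rfl fun i _ => ?_
  rw [show i + 1 + j = j + i + 1 by omega, add_comm i j]

theorem totalAngle_subChain (f : ℕ → ℂ) (j : ℕ) (z : ℂ) :
    totalAngle (subChain f j) (j + 1) z = totalAngle f j z + arg ((f 0 - z) / (f j - z)) := by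
  rw [totalAngle, Finset.sum_range_succ, totalAngle]
  congr 1
  · refine Finset.sum_congr rfl fun i hi => ?_
    have := Finset.mem_range.1 hi
    rw [edgeAngle, edgeAngle, subChain_apply this.le, subChain_apply this]
  · rw [edgeAngle, subChain_apply le_rfl]
    simp [subChain]

/-- A diagonal traversed in both directions contributes nothing. Off the segment the argument is
never `π`, the one value at which inversion does not negate `arg`. -/
theorem arg_div_add_arg_div {a b z : ℂ} (h : z ∉ segment ℝ a b) :
    arg ((b - z) / (a - z)) + arg ((a - z) / (b - z)) = 0 := by
  have h1 := (mem_slitPlane_iff_arg.1 (div_mem_slitPlane h)).1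
  rw [← inv_div (b - z) (a - z), arg_inv, if_neg h1]
  ring

theorem carrier_subChain_subset {f : ℕ → ℂ} {m j : ℕ} (hj : j ≤ m) :
    carrier (subChain f j) (j + 1) ⊆ carrier f m ∪ segment ℝ (f 0) (f j) := by
  rw [carrier_subChain]
  refine union_subset_union_left _ ?_
  rintro z ⟨i, hi, hz⟩
  exact ⟨i, by omega, hz⟩

namespace IsSimpleChain

variable {f : ℕ → ℂ} {m : ℕ}

/-- The region enclosed by a simple chain is covered by the two regions into which a diagonal
cuts it. -/
theorem enclosed_subset_union (h : IsSimpleChain f m) {j : ℕ} (hj : j ≤ m) :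
    enclosed (carrier f m) ⊆ enclosed (carrier (PlaneChain.subChain f j) (j + 1)) ∪
      enclosed (carrier (PlaneChain.subChain (fun i => f (i + j)) (m - j)) (m - j + 1)) := by
  intro x hx
  have hcar : carrier f m = carrier f j ∪ carrier (fun i => f (i + j)) (m - j) := by
    rw [← carrier_add, Nat.add_sub_cancel' hj]
  have htot : totalAngle f m x = totalAngle f j x + totalAngle (fun i => f (i + j)) (m - j) x := by
    rw [← totalAngle_add, Nat.add_sub_cancel' hj]
  have hm : f (m - j + j) = f 0 := by rw [Nat.sub_add_cancel hj, h.zero_eq]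
  have hsub : ∀ (g : ℕ → ℂ) (k : ℕ), PlaneChain.subChain g k (k + 1) = PlaneChain.subChain g k 0 :=
    fun g k => by simp [PlaneChain.subChain]
  by_cases hxK : x ∈ carrier f m
  · rw [hcar] at hxK
    rcases hxK with hxK | hxK
    · exact Or.inl (Or.inl (by rw [PlaneChain.carrier_subChain]; exact Or.inl hxK))
    · exact Or.inr (Or.inl (by rw [PlaneChain.carrier_subChain]; exact Or.inl hxK))
  by_cases hxd : x ∈ segment ℝ (f 0) (f j)
  · exact Or.inl (Or.inl (by rw [PlaneChain.carrier_subChain]; exact Or.inr hxd))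
  have hne := h.totalAngle_ne_zero hxK hx
  by_contra hcon
  rw [mem_union, not_or] at hcon
  -- Outside both pieces the two total angles vanish; since the diagonal cancels, their sum is the
  -- nonzero total angle of the whole chain.
  have h1 := totalAngle_eq_zero_of_notMem (hsub _ _) hcon.1
  have h2 := totalAngle_eq_zero_of_notMem (hsub _ _) hcon.2
  rw [totalAngle_subChain] at h1 h2
  simp only [hm, zero_add] at h2
  have h3 := arg_div_add_arg_div hxd
  apply hne
  linarith

/-! ### The corner at a vertex of maximal norm -/

theorem inner_neg_of_norm_le {v u : ℂ} (hn : ‖u‖ ≤ ‖v‖) (hne : u ≠ v) :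
    v.re * (u - v).re + v.im * (u - v).im < 0 := by
  have h1 : ‖u‖ ^ 2 ≤ ‖v‖ ^ 2 := by gcongr
  have h2 : 0 < ‖u - v‖ ^ 2 := by
    have := norm_pos_iff.2 (sub_ne_zero.2 hne)
    positivity
  rw [← normSq_eq_norm_sq, normSq_apply] at h2
  rw [← normSq_eq_norm_sq, ← normSq_eq_norm_sq, normSq_apply, normSq_apply] at h1
  simp only [sub_re, sub_im] at *
  nlinarith

/-- Both edges at an extreme vertex have negative inner product with its position vector. Parallel
edges would have to point in opposite directions, which gives opposite signs; hence straight angles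
do not occur here. -/
theorem cross_ne_zero (h : IsSimpleChain f m) (hmax : ∀ i, ‖f i‖ ≤ ‖f 0‖) :
    cross (f 1 - f 0) (f (m - 1) - f 0) ≠ 0 := by
  have h3 := h.three_le
  intro h0
  have h1 : f 1 ≠ f 0 := (h.ne_of_lt one_pos (by omega)).symm
  have h2 : f (m - 1) ≠ f 0 := (h.ne_of_lt (by omega) (by omega)).symm
  obtain ⟨c, hc⟩ := exists_smul_eq_of_cross_eq_zero (sub_ne_zero.2 h1) h0
  have hneg := neg_of_segment_inter_subset h1 h2 h.segment_inter_subset hc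
  have h4 := inner_neg_of_norm_le (hmax 1) h1
  have h5 := inner_neg_of_norm_le (hmax (m - 1)) h2
  rw [hc] at h5
  simp only [real_smul, mul_re, mul_im, ofReal_re, ofReal_im, zero_mul, sub_zero, add_zero] at h5
  nlinarith

theorem carrier_subset_closedBall (hmax : ∀ i, ‖f i‖ ≤ ‖f 0‖) :
    carrier f m ⊆ Metric.closedBall 0 ‖f 0‖ := by
  rintro z ⟨i, -, hz⟩
  exact (convex_closedBall 0 _).segment_subset (mem_closedBall_zero_iff.2 (hmax i))
    (mem_closedBall_zero_iff.2 (hmax (i + 1))) hz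

/-- At a vertex of maximal norm, the convex sector between the two edges is enclosed. -/
theorem exists_ball_sector_subset (h : IsSimpleChain f m) (hmax : ∀ i, ‖f i‖ ≤ ‖f 0‖) :
    ∃ r > 0, Metric.ball (f 0) r ∩ sector (f 0) (f 1 - f 0) (f (m - 1) - f 0) ⊆
      enclosed (carrier f m) := by
  have h3 := h.three_le
  obtain ⟨r, hr, h1, h2, hK⟩ := h.exists_ball_vertex
  have hT := twoSided_corner hr h1 h2 hK (h.cross_ne_zero hmax)
  obtain ⟨x, hx, hxne⟩ : ∃ x, x ∉ carrier f m ∧ totalAngle f m x ≠ 0 := by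
    obtain ⟨z₁, -, z₂, -, h1K, h2K, hne⟩ := h.exists_totalAngle_ne one_pos
    by_cases h0 : totalAngle f m z₁ = 0
    · exact ⟨z₂, h2K, fun h2 => hne (h0.trans h2.symm)⟩
    · exact ⟨z₁, h1K, h0⟩
  have hxe := mem_enclosed_of_totalAngle h.zero_eq hxne
  rcases hT.subset_component
    (h.carrier_subset_closure hx ⟨0, by omega, left_mem_edge f 0⟩) with ⟨hA, -⟩ | ⟨hB, -⟩
  · exact ⟨r, hr, fun z hz => enclosed_of_component hxe (hA hz)⟩
  -- If the component of `x` contained the outer side of the corner, it would contain a point of the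
  -- ray `R` that leaves the disc through `f 0`, where the total angle is zero.
  exfalso
  have hv : 0 < ‖f 0‖ := by
    by_contra! hle
    have e0 := norm_le_zero_iff.1 hle
    have e1 := norm_le_zero_iff.1 ((hmax 1).trans hle)
    exact h.ne_of_lt one_pos (by omega) (e0.trans e1.symm)
  set R : Set ℂ := (fun t : ℝ => t • f 0) '' Ioi 1 with hR
  have hRp : IsPreconnected R := isPreconnected_Ioi.image _ (by fun_prop)
  have hRK : R ⊆ (carrier f m)ᶜ := by
    rintro _ ⟨t, ht, rfl⟩ hK
    have := carrier_subset_closedBall hmax hK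
    rw [mem_closedBall_zero_iff, norm_smul, Real.norm_eq_abs,
      abs_of_pos (zero_lt_one.trans ht)] at this
    have ht : 1 < t := ht
    nlinarith
  have hRb : ¬ Bornology.IsBounded R := by
    intro hb
    obtain ⟨M, hM⟩ := hb.subset_closedBall 0
    have h1 : 1 < 2 + |M| / ‖f 0‖ := by
      have : 0 ≤ |M| / ‖f 0‖ := by positivity
      linarith
    have h2 := hM ⟨_, h1, rfl⟩
    rw [mem_closedBall_zero_iff, norm_smul, Real.norm_eq_abs, abs_of_pos (zero_lt_one.trans h1),
      add_mul, div_mul_cancel₀ _ hv.ne'] at h2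
    linarith [le_abs_self M]
  -- With this `ε` the point `(1 + ε) • f 0` has distance `r / 2` from `f 0`.
  set ε := r / (2 * ‖f 0‖) with hε
  have hεpos : 0 < ε := by positivity
  have hzR : (1 + ε) • f 0 ∈ R := ⟨1 + ε, by simpa using hεpos, rfl⟩
  have hsub : (1 + ε) • f 0 - f 0 = ε • f 0 := by rw [add_smul, one_smul]; ring
  have hzB : (1 + ε) • f 0 ∈ Metric.ball (f 0) r ∩ coSector (f 0) (f 1 - f 0) (f (m - 1) - f 0) := by
    constructor
    · rw [Metric.mem_ball, dist_eq_norm, hsub, norm_smul, Real.norm_eq_abs, abs_of_pos hεpos, hε]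
      field_simp
      linarith
    · rw [coSector, mem_ofPred_eq, hsub]
      by_contra! hcon
      have hdec := coord_decomp (h.cross_ne_zero hmax) (ε • f 0)
      have h4 := inner_neg_of_norm_le (hmax 1) (h.ne_of_lt one_pos (by omega)).symm
      have h5 := inner_neg_of_norm_le (hmax (m - 1)) (h.ne_of_lt (by omega) (by omega)).symm
      set s := coordLeft (f 1 - f 0) (f (m - 1) - f 0) (ε • f 0)
      set t := coordRight (f 1 - f 0) (f (m - 1) - f 0) (ε • f 0)
      have hre := congrArg re hdec
      have him := congrArg im hdec
      simp only [add_re, add_im, real_smul, mul_re, mul_im, ofReal_re, ofReal_im, zero_mul,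
        sub_zero, add_zero] at hre him
      have hsq : 0 < (f 0).re * (f 0).re + (f 0).im * (f 0).im := by
        rw [← normSq_apply, normSq_eq_norm_sq]
        positivity
      have e1 := mul_nonpos_of_nonneg_of_nonpos hcon.1 h4.le
      have e2 := mul_nonpos_of_nonneg_of_nonpos hcon.2 h5.le
      have e3 := mul_pos hεpos hsq
      -- The inner product with `f 0` is positive for the outward vector and negative for both edge
      -- vectors, so the outward vector is not a nonnegative combination of them.
      have e4 : ε * ((f 0).re * (f 0).re + (f 0).im * (f 0).im)
          = s * ((f 0).re * (f 1 - f 0).re + (f 0).im * (f 1 - f 0).im)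
            + t * ((f 0).re * (f (m - 1) - f 0).re + (f 0).im * (f (m - 1) - f 0).im) := by
        linear_combination (f 0).re * hre + (f 0).im * him
      linarith
  have hz0 := totalAngle_eq_zero h.zero_eq hRp hRK hRb hzR
  have hzx := totalAngle_const h.zero_eq isPreconnected_connectedComponentIn
    (connectedComponentIn_subset _ _) (hB hzB) (mem_connectedComponentIn hx)
  exact hxne (hzx.symm.trans hz0)

end IsSimpleChain

/-! ### Affine coordinates at the corner -/

/-- The coefficient of the edge vector `f 1 - f 0` in the position of `z` relative to `f 0`. -/
noncomputable def cornerLeft (f : ℕ → ℂ) (m : ℕ) (z : ℂ) : ℝ :=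
  coordLeft (f 1 - f 0) (f (m - 1) - f 0) (z - f 0)

/-- The coefficient of the edge vector `f (m - 1) - f 0` in the position of `z` relative to
`f 0`. -/
noncomputable def cornerRight (f : ℕ → ℂ) (m : ℕ) (z : ℂ) : ℝ :=
  coordRight (f 1 - f 0) (f (m - 1) - f 0) (z - f 0)

section corner

variable {f : ℕ → ℂ} {m : ℕ}

theorem lineMap_sub_eq (x y v : ℂ) (θ : ℝ) :
    AffineMap.lineMap x y θ - v = (1 - θ) • (x - v) + θ • (y - v) := by
  rw [AffineMap.lineMap_apply_module]
  simp only [real_smul]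
  push_cast
  ring

theorem cornerLeft_lineMap (x y : ℂ) (θ : ℝ) : cornerLeft f m (AffineMap.lineMap x y θ) =
    (1 - θ) * cornerLeft f m x + θ * cornerLeft f m y := by
  rw [cornerLeft, lineMap_sub_eq, coordLeft_add, coordLeft_smul, coordLeft_smul]
  rfl

theorem cornerRight_lineMap (x y : ℂ) (θ : ℝ) : cornerRight f m (AffineMap.lineMap x y θ) =
    (1 - θ) * cornerRight f m x + θ * cornerRight f m y := by
  rw [cornerRight, lineMap_sub_eq, coordRight_add, coordRight_smul, coordRight_smul]
  rfl

theorem cornerLeft_zero : cornerLeft f m (f 0) = 0 := by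
  simp [cornerLeft, coordLeft, cross]

theorem cornerRight_zero : cornerRight f m (f 0) = 0 := by
  simp [cornerRight, coordRight, cross]

theorem cornerLeft_one (hD : cross (f 1 - f 0) (f (m - 1) - f 0) ≠ 0) :
    cornerLeft f m (f 1) = 1 := by
  simpa [cornerLeft] using coordLeft_comb hD 1 0

theorem cornerRight_one : cornerRight f m (f 1) = 0 := by
  simp [cornerRight, coordRight]

theorem cornerLeft_pred : cornerLeft f m (f (m - 1)) = 0 := by
  simp [cornerLeft, coordLeft]

theorem cornerRight_pred (hD : cross (f 1 - f 0) (f (m - 1) - f 0) ≠ 0) :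
    cornerRight f m (f (m - 1)) = 1 := by
  simpa [cornerRight] using coordRight_comb hD 0 1

theorem corner_decomp (hD : cross (f 1 - f 0) (f (m - 1) - f 0) ≠ 0) (z : ℂ) :
    z = f 0 + (cornerLeft f m z • (f 1 - f 0) + cornerRight f m z • (f (m - 1) - f 0)) := by
  rw [cornerLeft, cornerRight, ← coord_decomp hD]
  ring

theorem cornerRight_of_mem {z : ℂ} (hz : z ∈ segment ℝ (f 0) (f 1)) : cornerRight f m z = 0 := by
  rw [segment_eq_image_lineMap] at hz
  obtain ⟨θ, -, rfl⟩ := hz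
  rw [cornerRight_lineMap, cornerRight_zero, cornerRight_one]
  ring

theorem cornerLeft_of_mem {z : ℂ} (hz : z ∈ segment ℝ (f 0) (f (m - 1))) :
    cornerLeft f m z = 0 := by
  rw [segment_eq_image_lineMap] at hz
  obtain ⟨θ, -, rfl⟩ := hz
  rw [cornerLeft_lineMap, cornerLeft_zero, cornerLeft_pred]
  ring

theorem mem_of_cornerRight_eq_zero (hD : cross (f 1 - f 0) (f (m - 1) - f 0) ≠ 0) {z : ℂ}
    (h0 : cornerRight f m z = 0) (h1 : 0 ≤ cornerLeft f m z) (h2 : cornerLeft f m z ≤ 1) :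
    z ∈ segment ℝ (f 0) (f 1) := by
  rw [segment_eq_image']
  have := corner_decomp hD z
  rw [h0, zero_smul, add_zero] at this
  exact ⟨_, ⟨h1, h2⟩, this.symm⟩

theorem mem_of_cornerLeft_eq_zero (hD : cross (f 1 - f 0) (f (m - 1) - f 0) ≠ 0) {z : ℂ}
    (h0 : cornerLeft f m z = 0) (h1 : 0 ≤ cornerRight f m z) (h2 : cornerRight f m z ≤ 1) :
    z ∈ segment ℝ (f 0) (f (m - 1)) := by
  rw [segment_eq_image']
  have := corner_decomp hD z
  rw [h0, zero_smul, zero_add] at this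
  exact ⟨_, ⟨h1, h2⟩, this.symm⟩

end corner

/-- A segment leaving the open quadrant has a first boundary point. The `wlog` inequality says that
the first coordinate vanishes no later than the second, and `s₀ / (s₀ - s₁)` is the time at which it
does. -/
theorem exists_exit {s₀ t₀ s₁ t₁ : ℝ} (hs : 0 < s₀) (ht : 0 < t₀) (h : s₁ < 0 ∨ t₁ < 0) :
    ∃ θ ∈ Icc (0 : ℝ) 1,
      ((1 - θ) * s₀ + θ * s₁ = 0 ∧ 0 ≤ (1 - θ) * t₀ + θ * t₁) ∨
      ((1 - θ) * t₀ + θ * t₁ = 0 ∧ 0 ≤ (1 - θ) * s₀ + θ * s₁) := by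
  wlog hle : t₀ * s₁ ≤ s₀ * t₁ generalizing s₀ t₀ s₁ t₁
  · obtain ⟨θ, h1, h2⟩ := this ht hs h.symm (le_of_not_ge hle)
    exact ⟨θ, h1, h2.symm⟩
  have hs1 : s₁ < 0 := by
    rcases h with h | h
    · exact h
    · by_contra! hcon
      nlinarith
  have hd : 0 < s₀ - s₁ := by linarith
  refine ⟨s₀ / (s₀ - s₁), ⟨by positivity, (div_le_one hd).2 (by linarith)⟩, Or.inl ⟨?_, ?_⟩⟩
  · field_simp
    ring
  · have : (1 - s₀ / (s₀ - s₁)) * t₀ + s₀ / (s₀ - s₁) * t₁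
        = (s₀ * t₁ - t₀ * s₁) / (s₀ - s₁) := by
      field_simp
      ring
    rw [this]
    exact div_nonneg (by linarith) hd.le

/-! ### Existence of diagonals -/

namespace IsSimpleChain

variable {f : ℕ → ℂ} {m : ℕ}

/-- If every vertex in the triangle at the corner `f 0` has height at least `κ` below the corner,
then the part of this triangle of height less than `κ` is disjoint from the chain. -/
theorem notMem_of_corner (h : IsSimpleChain f m)
    (hD : cross (f 1 - f 0) (f (m - 1) - f 0) ≠ 0) {κ : ℝ} (hκ : κ ≤ 1)
    (hX : ∀ j, 2 ≤ j → j + 2 ≤ m → 0 ≤ cornerLeft f m (f j) → 0 ≤ cornerRight f m (f j) →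
      κ ≤ cornerLeft f m (f j) + cornerRight f m (f j))
    {z : ℂ} (hs : 0 < cornerLeft f m z) (ht : 0 < cornerRight f m z)
    (hlt : cornerLeft f m z + cornerRight f m z < κ) : z ∉ carrier f m := by
  have h3 := h.three_le
  rintro ⟨i, hi, hz⟩
  have hi0 : i ≠ 0 := by
    rintro rfl
    exact ht.ne' (cornerRight_of_mem hz)
  have him : i ≠ m - 1 := by
    rintro rfl
    rw [h.edge_last] at hz
    exact hs.ne' (cornerLeft_of_mem hz)
  -- The height `cornerLeft + cornerRight` is affine on the edge, so one endpoint is no higher than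
  -- `z`; as the edge is not at the corner, this endpoint is not `f 0`.
  obtain ⟨k, hk0, hkm, hk, hle⟩ : ∃ k, 0 < k ∧ k < m ∧ f k ∈ edge f i ∧
      cornerLeft f m (f k) + cornerRight f m (f k) ≤ cornerLeft f m z + cornerRight f m z := by
    by_contra! hcon
    have h1 := hcon i (by omega) hi (left_mem_edge f i)
    have h2 := hcon (i + 1) (by omega) (by omega) (right_mem_edge f i)
    rw [edge, segment_eq_image_lineMap] at hz
    obtain ⟨θ, ⟨hθ0, hθ1⟩, rfl⟩ := hz
    rw [cornerLeft_lineMap, cornerRight_lineMap] at h1 h2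
    rcases le_total (cornerLeft f m (f i) + cornerRight f m (f i))
      (cornerLeft f m (f (i + 1)) + cornerRight f m (f (i + 1))) with hc | hc
    · nlinarith [mul_nonneg hθ0 (sub_nonneg.2 hc)]
    · nlinarith [mul_nonneg (sub_nonneg.2 hθ1) (sub_nonneg.2 hc)]
  have hseg : segment ℝ z (f k) ⊆ edge f i := (convex_segment _ _).segment_subset hz hk
  -- If `f k` is outside the cone, the edge leaves the cone below height `1` through an edge at `f
  -- 0`, where only a common vertex, of height `1`, would be allowed. If it is inside, its height is
  -- at least `κ`.
  by_cases hneg : cornerLeft f m (f k) < 0 ∨ cornerRight f m (f k) < 0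
  · obtain ⟨θ, hθ, hex⟩ := exists_exit hs ht hneg
    set y : ℂ := AffineMap.lineMap z (f k) θ with hy
    have hyi : y ∈ edge f i := hseg (by rw [segment_eq_image_lineMap]; exact ⟨θ, hθ, rfl⟩)
    rw [← cornerLeft_lineMap, ← cornerRight_lineMap, ← hy] at hex
    have hsum : cornerLeft f m y + cornerRight f m y < 1 := by
      rw [hy, cornerLeft_lineMap, cornerRight_lineMap]
      nlinarith [hθ.1, hθ.2]
    rcases hex with ⟨h1, h2⟩ | ⟨h1, h2⟩
    · have hyE := mem_of_cornerLeft_eq_zero hD h1 h2 (by linarith)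
      rw [← h.edge_last] at hyE
      rcases h.meet i (m - 1) (by omega) (by omega) y hyi hyE with ⟨_, h4⟩ | ⟨h4, _⟩
      · rw [h4, cornerLeft_pred, cornerRight_pred hD] at hsum
        linarith
      · exact hi0 h4
    · have hyE : y ∈ edge f 0 := mem_of_cornerRight_eq_zero hD h1 h2 (by linarith)
      rcases h.meet 0 i (by omega) hi y hyE hyi with ⟨h5, h4⟩ | ⟨_, h4, _⟩
      · rw [h5, zero_add] at h4
        rw [h4, cornerLeft_one hD, cornerRight_one] at hsum
        linarith
      · omega
  · push Not at hneg
    have hk1 : k ≠ 1 := by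
      rintro rfl
      rw [cornerLeft_one hD, cornerRight_one] at hle
      linarith
    have hkm1 : k ≠ m - 1 := by
      rintro rfl
      rw [cornerLeft_pred, cornerRight_pred hD] at hle
      linarith
    have := hX k (by omega) (by omega) hneg.1 hneg.2
    linarith

/-- The segment from an extreme corner `f 0` to a visible point of the opposite side or below is
enclosed. -/
theorem corner_openSegment (h : IsSimpleChain f m) (hmax : ∀ i, ‖f i‖ ≤ ‖f 0‖) {κ : ℝ}
    (hκ : κ ≤ 1)
    (hX : ∀ j, 2 ≤ j → j + 2 ≤ m → 0 ≤ cornerLeft f m (f j) → 0 ≤ cornerRight f m (f j) →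
      κ ≤ cornerLeft f m (f j) + cornerRight f m (f j))
    {q : ℂ} (hs : 0 < cornerLeft f m q) (ht : 0 < cornerRight f m q)
    (hle : cornerLeft f m q + cornerRight f m q ≤ κ) :
    Disjoint (openSegment ℝ (f 0) q) (carrier f m) ∧
      segment ℝ (f 0) q ⊆ enclosed (carrier f m) := by
  have h3 := h.three_le
  have hD := h.cross_ne_zero hmax
  have hpt : ∀ θ ∈ Ioo (0 : ℝ) 1, 0 < cornerLeft f m (AffineMap.lineMap (f 0) q θ) ∧
      0 < cornerRight f m (AffineMap.lineMap (f 0) q θ) ∧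
      AffineMap.lineMap (f 0) q θ ∉ carrier f m := by
    rintro θ ⟨h0, h1⟩
    have e1 : cornerLeft f m (AffineMap.lineMap (f 0) q θ) = θ * cornerLeft f m q := by
      rw [cornerLeft_lineMap, cornerLeft_zero]; ring
    have e2 : cornerRight f m (AffineMap.lineMap (f 0) q θ) = θ * cornerRight f m q := by
      rw [cornerRight_lineMap, cornerRight_zero]; ring
    have p1 : 0 < θ * cornerLeft f m q := mul_pos h0 hs
    have p2 : 0 < θ * cornerRight f m q := mul_pos h0 ht
    refine ⟨e1 ▸ p1, e2 ▸ p2, h.notMem_of_corner hD hκ hX (e1 ▸ p1) (e2 ▸ p2) ?_⟩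
    rw [e1, e2]
    nlinarith
  have hdis : Disjoint (openSegment ℝ (f 0) q) (carrier f m) := by
    rw [disjoint_left, openSegment_eq_image_lineMap]
    rintro _ ⟨θ, hθ, rfl⟩
    exact (hpt θ hθ).2.2
  have hpre : IsPreconnected (openSegment ℝ (f 0) q) := (convex_openSegment _ _).isPreconnected
  obtain ⟨x, hx, hxe⟩ : ∃ x ∈ openSegment ℝ (f 0) q, x ∈ enclosed (carrier f m) := by
    obtain ⟨r, hr, hsub⟩ := h.exists_ball_sector_subset hmax
    have h0 : f 0 ∈ closure (openSegment ℝ (f 0) q) :=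
      segment_subset_closure_openSegment (left_mem_segment ℝ _ _)
    obtain ⟨x, hxb, hxo⟩ := mem_closure_iff.1 h0 _ Metric.isOpen_ball (Metric.mem_ball_self hr)
    refine ⟨x, hxo, hsub ⟨hxb, ?_⟩⟩
    rw [openSegment_eq_image_lineMap] at hxo
    obtain ⟨θ, hθ, rfl⟩ := hxo
    exact ⟨(hpt θ hθ).1, (hpt θ hθ).2.1⟩
  refine ⟨hdis, fun z hz => ?_⟩
  by_cases hzK : z ∈ carrier f m
  · exact Or.inl hzK
  have hins : IsPreconnected (insert z (openSegment ℝ (f 0) q)) :=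
    hpre.subset_closure (subset_insert _ _)
      (insert_subset (segment_subset_closure_openSegment hz) subset_closure)
  refine enclosed_of_isPreconnected hins ?_ (mem_insert_of_mem _ hx) (mem_insert _ _) hxe
  rw [disjoint_left]
  rintro y (rfl | hy)
  exacts [hzK, disjoint_left.1 hdis hy]

/-- An ear: if no vertex lies in the triangle at the extreme corner `f 0`, then its neighbours
are joined by a diagonal. -/
theorem ear_openSegment (h : IsSimpleChain f m) (h4 : 4 ≤ m) (hmax : ∀ i, ‖f i‖ ≤ ‖f 0‖)
    (hX : ∀ j, 2 ≤ j → j + 2 ≤ m → 0 ≤ cornerLeft f m (f j) → 0 ≤ cornerRight f m (f j) →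
      1 < cornerLeft f m (f j) + cornerRight f m (f j)) :
    Disjoint (openSegment ℝ (f 1) (f (m - 1))) (carrier f m) ∧
      segment ℝ (f 1) (f (m - 1)) ⊆ enclosed (carrier f m) := by
  have hD := h.cross_ne_zero hmax
  have hX' : ∀ j, 2 ≤ j → j + 2 ≤ m → 0 ≤ cornerLeft f m (f j) → 0 ≤ cornerRight f m (f j) →
      1 ≤ cornerLeft f m (f j) + cornerRight f m (f j) :=
    fun j h1 h2 h3 h5 => (hX j h1 h2 h3 h5).le
  have hpt : ∀ z ∈ openSegment ℝ (f 1) (f (m - 1)), 0 < cornerLeft f m z ∧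
      0 < cornerRight f m z ∧ cornerLeft f m z + cornerRight f m z = 1 := by
    intro z hz
    rw [openSegment_eq_image_lineMap] at hz
    obtain ⟨θ, ⟨h0, h1⟩, rfl⟩ := hz
    rw [cornerLeft_lineMap, cornerRight_lineMap, cornerLeft_one hD, cornerRight_one,
      cornerLeft_pred, cornerRight_pred hD]
    refine ⟨?_, ?_, ?_⟩ <;> linarith
  have hmem : ∀ (i : ℕ) (a b : ℂ) (θ : ℝ), a ∈ edge f i → b ∈ edge f i → θ ∈ Icc (0 : ℝ) 1 →
      AffineMap.lineMap a b θ ∈ edge f i := fun i a b θ ha hb hθ =>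
    (convex_segment _ _).segment_subset ha hb (by
      rw [segment_eq_image_lineMap]; exact ⟨θ, hθ, rfl⟩)
  have hdis : Disjoint (openSegment ℝ (f 1) (f (m - 1))) (carrier f m) := by
    rw [disjoint_left]
    rintro z hz ⟨i, hi, hzi⟩
    obtain ⟨hs, ht, hst⟩ := hpt z hz
    -- An edge meeting the open ear diagonal cannot go below height `1`: immediately after `z` it
    -- would enter the empty open triangle.
    have hge : ∀ p ∈ edge f i, 1 ≤ cornerLeft f m p + cornerRight f m p := by
      intro p hp
      by_contra! hlt
      have hline : Continuous fun θ : ℝ => (AffineMap.lineMap z p θ : ℂ) :=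
        AffineMap.lineMap_continuous
      have hcs : Continuous fun θ : ℝ => cornerLeft f m (AffineMap.lineMap z p θ) := by
        simp only [cornerLeft_lineMap]; fun_prop
      have hct : Continuous fun θ : ℝ => cornerRight f m (AffineMap.lineMap z p θ) := by
        simp only [cornerRight_lineMap]; fun_prop
      have e1 : ∀ᶠ θ : ℝ in 𝓝[>] 0, 0 < cornerLeft f m (AffineMap.lineMap z p θ) :=
        nhdsWithin_le_nhds (hcs.tendsto 0 (lt_mem_nhds (by simpa using hs)))
      have e2 : ∀ᶠ θ : ℝ in 𝓝[>] 0, 0 < cornerRight f m (AffineMap.lineMap z p θ) :=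
        nhdsWithin_le_nhds (hct.tendsto 0 (lt_mem_nhds (by simpa using ht)))
      have e3 : ∀ᶠ θ : ℝ in 𝓝[>] 0, θ ≤ 1 := nhdsWithin_le_nhds (ge_mem_nhds one_pos)
      have e4 : ∀ᶠ θ : ℝ in 𝓝[>] 0, 0 < θ := self_mem_nhdsWithin
      obtain ⟨θ, h1, h2, h3, h5⟩ := (e1.and (e2.and (e3.and e4))).exists
      refine h.notMem_of_corner hD le_rfl hX' h1 h2 ?_ ⟨i, hi, hmem i z p θ hzi hp ⟨h5.le, h3⟩⟩
      rw [cornerLeft_lineMap, cornerRight_lineMap]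
      nlinarith
    have hXi : ∀ k, 2 ≤ k → k + 2 ≤ m → cornerLeft f m (f k) + cornerRight f m (f k) = 1 →
        0 ≤ cornerLeft f m (f k) → cornerLeft f m (f k) ≤ 1 → False := fun k h1 h2 h3 h5 h6 =>
      (hX k h1 h2 h5 (by linarith)).ne' h3
    have hend : ∀ k < m, cornerLeft f m (f k) + cornerRight f m (f k) = 1 →
        cornerLeft f m (f k) ≤ 0 ∨ 1 ≤ cornerLeft f m (f k) := by
      intro k hk h1
      by_contra! hcon
      rcases Nat.lt_or_ge k 2 with h2 | h2
      · interval_cases k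
        · rw [cornerLeft_zero] at hcon
          exact lt_irrefl _ hcon.1
        · rw [cornerLeft_one hD] at hcon
          exact lt_irrefl _ hcon.2
      · rcases eq_or_ne k (m - 1) with rfl | h3
        · rw [cornerLeft_pred] at hcon
          exact lt_irrefl _ hcon.1
        · exact hXi k h2 (by omega) h1 hcon.1.le hcon.2.le
    have hend' : ∀ k ≤ m, cornerLeft f m (f k) + cornerRight f m (f k) = 1 →
        cornerLeft f m (f k) ≤ 0 ∨ 1 ≤ cornerLeft f m (f k) := by
      intro k hk
      rcases hk.lt_or_eq with hk | rfl
      · exact hend k hk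
      · rw [h.zero_eq]
        exact hend 0 (by omega)
    have hzi' := hzi
    rcases mem_openSegment_or hzi' with rfl | rfl | hzo
    · rcases hend' i hi.le hst with h1 | h1 <;> linarith
    · rcases hend' (i + 1) hi hst with h1 | h1 <;> linarith
    rw [openSegment_eq_image_lineMap] at hzo
    obtain ⟨θ, ⟨hθ0, hθ1⟩, rfl⟩ := hzo
    have g1 := hge _ (left_mem_edge f i)
    have g2 := hge _ (right_mem_edge f i)
    rw [cornerLeft_lineMap] at hs hst
    rw [cornerRight_lineMap] at ht hst
    -- An interior point of the edge has the minimal height `1`, so both endpoints have height `1`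
    -- and the edge lies on the line of the diagonal.
    have s1 : cornerLeft f m (f i) + cornerRight f m (f i) = 1 := by nlinarith
    have s2 : cornerLeft f m (f (i + 1)) + cornerRight f m (f (i + 1)) = 1 := by nlinarith
    -- The endpoints lie on opposite sides of the open diagonal, so the edge covers it entirely and
    -- contains both `f 1` and `f (m - 1)`. No edge does so when `4 ≤ m`.
    have hfind : ∀ c ∈ Icc (0 : ℝ) 1, ∃ y ∈ edge f i, cornerLeft f m y = c ∧
        cornerRight f m y = 1 - c := by
      rintro c ⟨hc0, hc1⟩
      have hcont : Continuous fun θ : ℝ => cornerLeft f m (AffineMap.lineMap (f i) (f (i + 1)) θ) := by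
        simp only [cornerLeft_lineMap]; fun_prop
      have hc : c ∈ (fun θ : ℝ => cornerLeft f m (AffineMap.lineMap (f i) (f (i + 1)) θ)) ''
          Icc 0 1 := by
        rcases hend' i hi.le s1 with h5 | h5 <;> rcases hend' (i + 1) hi s2 with h6 | h6
        · exfalso; nlinarith
        · apply intermediate_value_Icc zero_le_one hcont.continuousOn
          simp only [AffineMap.lineMap_apply_zero, AffineMap.lineMap_apply_one]
          exact ⟨by linarith, by linarith⟩
        · apply intermediate_value_Icc' zero_le_one hcont.continuousOn
          simp only [AffineMap.lineMap_apply_zero, AffineMap.lineMap_apply_one]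
          exact ⟨by linarith, by linarith⟩
        · exfalso; nlinarith
      obtain ⟨θ, hθ, hθc⟩ := hc
      refine ⟨_, hmem i _ _ θ (left_mem_edge f i) (right_mem_edge f i) hθ, hθc, ?_⟩
      simp only at hθc
      rw [cornerLeft_lineMap] at hθc
      rw [cornerRight_lineMap]
      linear_combination (1 - θ) * s1 + θ * s2 - hθc
    have hone : f 1 ∈ edge f i := by
      obtain ⟨y, hy, h1, h2⟩ := hfind 1 ⟨zero_le_one, le_rfl⟩
      have e1 := corner_decomp hD y
      rw [h1, h2] at e1
      have : y = f 1 := by rw [e1]; simp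
      rwa [← this]
    have hpred : f (m - 1) ∈ edge f i := by
      obtain ⟨y, hy, h1, h2⟩ := hfind 0 ⟨le_rfl, zero_le_one⟩
      have e1 := corner_decomp hD y
      rw [h1, h2] at e1
      have : y = f (m - 1) := by rw [e1]; simp
      rwa [← this]
    have k1 := h.vertex_mem_edge (by omega) hi hone
    have k2 := h.vertex_mem_edge (by omega) hi hpred
    omega
  refine ⟨hdis, fun z hz => ?_⟩
  rcases mem_openSegment_or hz with rfl | rfl | hzo
  · exact Or.inl ⟨1, by omega, left_mem_edge f 1⟩
  · exact Or.inl ⟨m - 1, by omega, left_mem_edge f _⟩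
  · obtain ⟨hs, ht, hst⟩ := hpt z hzo
    exact (h.corner_openSegment hmax le_rfl hX' hs ht hst.le).2 (right_mem_segment ℝ _ _)

/-- A simple chain with at least four vertices has a diagonal at an extreme corner. -/
theorem exists_diagonal_of_max (h : IsSimpleChain f m) (h4 : 4 ≤ m)
    (hmax : ∀ i, ‖f i‖ ≤ ‖f 0‖) :
    ∃ r j, 2 ≤ j ∧ j + 2 ≤ m ∧ Disjoint (openSegment ℝ (f r) (f (j + r))) (carrier f m) ∧
      segment ℝ (f r) (f (j + r)) ⊆ enclosed (carrier f m) := by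
  have hD := h.cross_ne_zero hmax
  classical
  by_cases hX : ∀ j, 2 ≤ j → j + 2 ≤ m → 0 ≤ cornerLeft f m (f j) → 0 ≤ cornerRight f m (f j) →
      1 < cornerLeft f m (f j) + cornerRight f m (f j)
  · refine ⟨1, m - 2, by omega, by omega, ?_⟩
    rw [show m - 2 + 1 = m - 1 by omega]
    exact h.ear_openSegment h4 hmax hX
  push Not at hX
  obtain ⟨j₀, h1, h2, h3, h5, h6⟩ := hX
  set X := (Finset.range m).filter fun j => 2 ≤ j ∧ j + 2 ≤ m ∧ 0 ≤ cornerLeft f m (f j) ∧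
    0 ≤ cornerRight f m (f j) with hXdef
  have hj₀ : j₀ ∈ X := by
    rw [hXdef, Finset.mem_filter, Finset.mem_range]
    exact ⟨by omega, h1, h2, h3, h5⟩
  -- A vertex of least height in the closed triangle: with `κ` equal to that height, nothing blocks
  -- the segment from `f 0` to it.
  obtain ⟨j, hj, hmin⟩ := X.exists_min_image
    (fun j => cornerLeft f m (f j) + cornerRight f m (f j)) ⟨j₀, hj₀⟩
  obtain ⟨hjm, hj2, hj3, hs, ht⟩ := by
    rw [hXdef, Finset.mem_filter, Finset.mem_range] at hj
    exact hj
  have hle : cornerLeft f m (f j) + cornerRight f m (f j) ≤ 1 := (hmin j₀ hj₀).trans h6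
  -- A vanishing coordinate would put `f j` on an edge at `f 0`, although it is neither `f 0` nor a
  -- neighbour.
  have hs' : 0 < cornerLeft f m (f j) := by
    refine lt_of_le_of_ne hs fun h0 => ?_
    have := mem_of_cornerLeft_eq_zero hD h0.symm ht (by linarith)
    rw [← h.edge_last] at this
    have := h.vertex_mem_edge hjm (by omega) this
    omega
  have ht' : 0 < cornerRight f m (f j) := by
    refine lt_of_le_of_ne ht fun h0 => ?_
    have : f j ∈ edge f 0 := mem_of_cornerRight_eq_zero hD h0.symm hs (by linarith)
    have := h.vertex_mem_edge hjm (by omega) this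
    omega
  refine ⟨0, j, hj2, hj3, h.corner_openSegment hmax hle (fun i hi1 hi2 hi3 hi4 => ?_) hs' ht' le_rfl⟩
  refine hmin i ?_
  rw [hXdef, Finset.mem_filter, Finset.mem_range]
  exact ⟨by omega, hi1, hi2, hi3, hi4⟩

theorem exists_max (h : IsSimpleChain f m) : ∃ r, ∀ i, ‖f i‖ ≤ ‖f r‖ := by
  have h3 := h.three_le
  obtain ⟨r, -, hr⟩ := (Finset.range m).exists_max_image (fun i => ‖f i‖)
    ⟨0, Finset.mem_range.2 (by omega)⟩
  refine ⟨r, fun i => ?_⟩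
  rw [← h.periodic_mod i]
  exact hr _ (Finset.mem_range.2 (Nat.mod_lt _ (by omega)))

/-- A simple chain with at least four vertices has a diagonal. -/
theorem exists_diagonal (h : IsSimpleChain f m) (h4 : 4 ≤ m) :
    ∃ r j, 2 ≤ j ∧ j + 2 ≤ m ∧ Disjoint (openSegment ℝ (f r) (f (j + r))) (carrier f m) ∧
      segment ℝ (f r) (f (j + r)) ⊆ enclosed (carrier f m) := by
  obtain ⟨k, hk⟩ := h.exists_max
  obtain ⟨r, j, h1, h2, h3⟩ := (h.shift k).exists_diagonal_of_max h4 fun i => by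
    simpa using hk (i + k)
  rw [h.carrier_shift, add_assoc] at h3
  exact ⟨r + k, j, h1, h2, h3⟩

end IsSimpleChain

/-! ### Triangles are convex -/

theorem notMem_enclosed_of_ray {K : Set ℂ} {x e : ℂ} (he : e ≠ 0)
    (h : ∀ t : ℝ, 0 ≤ t → x + t • e ∉ K) : x ∉ enclosed K := by
  have hx : x ∈ (fun t : ℝ => x + t • e) '' Ici 0 := ⟨0, le_refl (0 : ℝ), by simp⟩
  have hpre : IsPreconnected ((fun t : ℝ => x + t • e) '' Ici 0) :=
    isPreconnected_Ici.image _ (by fun_prop)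
  have hsub : (fun t : ℝ => x + t • e) '' Ici 0 ⊆ Kᶜ := by
    rintro _ ⟨t, ht, rfl⟩
    exact h t ht
  rintro (hxK | ⟨-, hb⟩)
  · exact hsub hx hxK
  obtain ⟨M, hM⟩ := (hb.subset (hpre.subset_connectedComponentIn hx hsub)).subset_closedBall x
  have he' := norm_pos_iff.2 he
  have h1 : (0 : ℝ) ≤ (|M| + 1) / ‖e‖ := by positivity
  have h2 := hM ⟨_, h1, rfl⟩
  rw [Metric.mem_closedBall, dist_eq_norm, add_sub_cancel_left, norm_smul, Real.norm_eq_abs,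
    abs_of_nonneg h1, div_mul_cancel₀ _ he'.ne'] at h2
  linarith [le_abs_self M]

theorem convex_corner (f : ℕ → ℂ) (m : ℕ) : Convex ℝ {z | 0 ≤ cornerLeft f m z ∧
    0 ≤ cornerRight f m z ∧ cornerLeft f m z + cornerRight f m z ≤ 1} := by
  rw [convex_iff_segment_subset]
  rintro x ⟨h1, h2, h3⟩ y ⟨h4, h5, h6⟩ z hz
  rw [segment_eq_image_lineMap] at hz
  obtain ⟨θ, ⟨hθ0, hθ1⟩, rfl⟩ := hz
  have hθ2 : 0 ≤ 1 - θ := by linarith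
  simp only [mem_ofPred_eq, cornerLeft_lineMap, cornerRight_lineMap]
  refine ⟨by positivity, by positivity, ?_⟩
  nlinarith

namespace IsSimpleChain

variable {f : ℕ → ℂ} {m : ℕ}

/-- A point violating one of the inequalities escapes to infinity along a ray that keeps violating
it. Conversely, `corner_openSegment` applies vacuously, there being no further vertices. -/
theorem enclosed_triangle_of_max (h : IsSimpleChain f 3) (hmax : ∀ i, ‖f i‖ ≤ ‖f 0‖) :
    enclosed (carrier f 3) = {z | 0 ≤ cornerLeft f 3 z ∧ 0 ≤ cornerRight f 3 z ∧
      cornerLeft f 3 z + cornerRight f 3 z ≤ 1} := by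
  have hD := h.cross_ne_zero hmax
  have hvert : ∀ i < 3, f i ∈ {z | 0 ≤ cornerLeft f 3 z ∧ 0 ≤ cornerRight f 3 z ∧
      cornerLeft f 3 z + cornerRight f 3 z ≤ 1} := by
    intro i hi
    have h1 := cornerLeft_one hD
    have h2 := cornerRight_pred hD
    have h3 : cornerLeft f 3 (f 2) = 0 := cornerLeft_pred
    have h4 : cornerRight f 3 (f 2) = 1 := h2
    interval_cases i <;>
      simp [cornerLeft_zero, cornerRight_zero, h1, cornerRight_one, h3, h4]
  have hK : carrier f 3 ⊆ {z | 0 ≤ cornerLeft f 3 z ∧ 0 ≤ cornerRight f 3 z ∧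
      cornerLeft f 3 z + cornerRight f 3 z ≤ 1} := by
    rintro z ⟨i, hi, hz⟩
    refine (convex_corner f 3).segment_subset (hvert i hi) ?_ hz
    rw [← h.periodic_mod]
    exact hvert _ (Nat.mod_lt _ (by norm_num))
  have ha : f 1 - f 0 ≠ 0 := sub_ne_zero.2 (h.ne_of_lt one_pos (by norm_num)).symm
  have hb : f (3 - 1) - f 0 ≠ 0 := sub_ne_zero.2 (h.ne_of_lt (by norm_num) (by norm_num)).symm
  have hL : ∀ (z e : ℂ) (ε : ℝ), cornerLeft f 3 (z + ε • e)
      = cornerLeft f 3 z + ε * coordLeft (f 1 - f 0) (f (3 - 1) - f 0) e := fun z e ε => by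
    rw [cornerLeft, add_sub_right_comm, coordLeft_add, coordLeft_smul]
    rfl
  have hR : ∀ (z e : ℂ) (ε : ℝ), cornerRight f 3 (z + ε • e)
      = cornerRight f 3 z + ε * coordRight (f 1 - f 0) (f (3 - 1) - f 0) e := fun z e ε => by
    rw [cornerRight, add_sub_right_comm, coordRight_add, coordRight_smul]
    rfl
  have e1 : coordLeft (f 1 - f 0) (f (3 - 1) - f 0) (f 1 - f 0) = 1 := cornerLeft_one hD
  have e2 : coordRight (f 1 - f 0) (f (3 - 1) - f 0) (f 1 - f 0) = 0 := cornerRight_one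
  have e3 : coordRight (f 1 - f 0) (f (3 - 1) - f 0) (f (3 - 1) - f 0) = 1 := cornerRight_pred hD
  apply Subset.antisymm
  · intro x hx
    refine ⟨?_, ?_, ?_⟩ <;> by_contra! hlt
    · refine notMem_enclosed_of_ray (e := (-1 : ℝ) • (f 1 - f 0)) (smul_ne_zero (by norm_num) ha)
        (fun t ht hK' => ?_) hx
      have := (hK hK').1
      rw [hL, coordLeft_smul, e1] at this
      linarith
    · refine notMem_enclosed_of_ray (e := (-1 : ℝ) • (f (3 - 1) - f 0)) (smul_ne_zero (by norm_num) hb)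
        (fun t ht hK' => ?_) hx
      have := (hK hK').2.1
      rw [hR, coordRight_smul, e3] at this
      linarith
    · refine notMem_enclosed_of_ray ha (fun t ht hK' => ?_) hx
      have := (hK hK').2.2
      rw [hL, hR, e1, e2] at this
      linarith
  · rintro x ⟨hs, ht, hst⟩
    rcases hs.eq_or_lt with hs0 | hs0
    · have := mem_of_cornerLeft_eq_zero hD hs0.symm ht (by linarith)
      rw [← h.edge_last] at this
      exact Or.inl ⟨2, by norm_num, this⟩
    rcases ht.eq_or_lt with ht0 | ht0
    · exact Or.inl ⟨0, by norm_num, mem_of_cornerRight_eq_zero hD ht0.symm hs (by linarith)⟩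
    · exact (h.corner_openSegment hmax le_rfl (fun j h1 h2 => by omega) hs0 ht0 hst).2
        (right_mem_segment ℝ _ _)

theorem convex_enclosed_triangle (h : IsSimpleChain f 3) : Convex ℝ (enclosed (carrier f 3)) := by
  obtain ⟨r, hr⟩ := h.exists_max
  rw [← h.carrier_shift r, (h.shift r).enclosed_triangle_of_max fun i => by simpa using hr (i + r)]
  exact convex_corner _ _

end IsSimpleChain

/-! ### Guarding three-colourings -/

/-- A proper `3`-colouring of the vertices of a closed chain each of whose colour classes guards
the enclosed region. -/
structure IsGuardColoring (f : ℕ → ℂ) (m : ℕ) (col : ℕ → Fin 3) : Prop where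
  periodic : ∀ i, col (i + m) = col i
  ne : ∀ i, col i ≠ col (i + 1)
  guard : ∀ x ∈ enclosed (carrier f m), ∀ k, ∃ i, col i = k ∧
    segment ℝ (f i) x ⊆ enclosed (carrier f m)

theorem IsGuardColoring.periodic_mod {f : ℕ → ℂ} {m : ℕ} {col : ℕ → Fin 3}
    (h : IsGuardColoring f m col) (i : ℕ) : col (i % m) = col i := by
  have hp : Function.Periodic col m := h.periodic
  exact hp.map_mod_nat i

theorem ne_succ_of_mod {m : ℕ} {col : ℕ → Fin 3} (hm : 0 < m) (h : ∀ i < m, col i ≠ col (i + 1))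
    (h0 : col m = col 0) (i : ℕ) : col (i % m) ≠ col ((i + 1) % m) := by
  have hlt := Nat.mod_lt i hm
  have := h _ hlt
  rw [← Nat.mod_add_mod]
  rcases (Nat.succ_le_of_lt hlt).lt_or_eq with h1 | h1
  · rwa [Nat.mod_eq_of_lt h1]
  · rw [Nat.succ_eq_add_one] at h1
    rw [h1, h0] at this
    rwa [h1, Nat.mod_self]

theorem exists_perm_of_ne : ∀ a b c d : Fin 3, a ≠ b → c ≠ d →
    ∃ σ : Equiv.Perm (Fin 3), σ a = c ∧ σ b = d := by
  decide

theorem IsSimpleChain.exists_coloring_of_shift {f : ℕ → ℂ} {m : ℕ} (h : IsSimpleChain f m) (r : ℕ)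
    {col : ℕ → Fin 3} (hc : IsGuardColoring (fun i => f (i + r)) m col) :
    ∃ col, IsGuardColoring f m col := by
  have h3 := h.three_le
  have hle : r ≤ r * m := Nat.le_mul_of_pos_right r (by omega)
  -- The number `r * m - r` represents `-r` modulo `m` without leaving the naturals.
  refine ⟨fun i => col (i + (r * m - r)), fun i => ?_, fun i => ?_, fun x hx k => ?_⟩
  · rw [add_right_comm, hc.periodic]
  · rw [add_right_comm]
    exact hc.ne _
  · obtain ⟨i, hi, hs⟩ := hc.guard x (by rwa [h.carrier_shift]) k
    rw [h.carrier_shift] at hs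
    refine ⟨i + r, ?_, hs⟩
    rw [← hc.periodic_mod, show i + r + (r * m - r) = i + r * m by omega, Nat.add_mul_mod_self_right,
      hc.periodic_mod, hi]

/-- The diagonal is an edge of both pieces, so both colourings are proper on it and one permutation
matches them there. A point guarded by each colour within its piece remains so in the whole, since
both pieces are enclosed by the original chain. -/
theorem IsSimpleChain.exists_coloring_of_diagonal {f : ℕ → ℂ} {m j : ℕ} (h : IsSimpleChain f m)
    (h2 : 2 ≤ j) (hj : j + 2 ≤ m) (hseg : segment ℝ (f 0) (f j) ⊆ enclosed (carrier f m))
    {c₁ c₂ : ℕ → Fin 3} (hc₁ : IsGuardColoring (PlaneChain.subChain f j) (j + 1) c₁)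
    (hc₂ : IsGuardColoring (PlaneChain.subChain (fun i => f (i + j)) (m - j)) (m - j + 1) c₂) :
    ∃ col, IsGuardColoring f m col := by
  have hsub₁ : enclosed (carrier (PlaneChain.subChain f j) (j + 1)) ⊆ enclosed (carrier f m) :=
    enclosed_subset (carrier_subChain_subset (by omega)) hseg
  have hsub₂ : enclosed (carrier (PlaneChain.subChain (fun i => f (i + j)) (m - j)) (m - j + 1)) ⊆
      enclosed (carrier f m) := by
    have := carrier_subChain_subset (f := fun i => f (i + j)) (Nat.sub_le m j)
    rw [h.carrier_shift, Nat.sub_add_cancel (by omega), h.zero_eq, zero_add, segment_symm] at this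
    exact enclosed_subset this hseg
  have n₁ : c₁ j ≠ c₁ 0 := by
    have := hc₁.periodic 0
    rw [zero_add] at this
    rw [← this]
    exact hc₁.ne j
  have n₂ : c₂ 0 ≠ c₂ (m - j) := by
    have := hc₂.periodic 0
    rw [zero_add] at this
    rw [← this]
    exact (hc₂.ne (m - j)).symm
  obtain ⟨σ, hσ1, hσ2⟩ := exists_perm_of_ne _ _ _ _ n₂ n₁
  set c : ℕ → Fin 3 := fun i => if i ≤ j then c₁ i else σ (c₂ (i - j)) with hc
  have cl : ∀ i ≤ j, c i = c₁ i := fun i hi => if_pos hi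
  have cr : ∀ i, j ≤ i → c i = σ (c₂ (i - j)) := by
    intro i hi
    rcases hi.eq_or_lt with rfl | hlt
    · rw [cl _ le_rfl, Nat.sub_self, hσ1]
    · exact if_neg (by omega)
  have c0 : c m = c 0 := by rw [cr m (by omega), hσ2, cl 0 (by omega)]
  have cmod : ∀ i ≤ m, c (i % m) = c i := by
    intro i hi
    rcases hi.lt_or_eq with hi | rfl
    · rw [Nat.mod_eq_of_lt hi]
    · rw [Nat.mod_self, c0]
  refine ⟨fun i => c (i % m), fun i => by simp, ne_succ_of_mod (by omega) (fun i hi => ?_) c0,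
    fun x hx k => ?_⟩
  · rcases Nat.lt_or_ge i j with hij | hij
    · rw [cl i hij.le, cl _ hij]
      exact hc₁.ne i
    · rw [cr i hij, cr (i + 1) (by omega), show i + 1 - j = i - j + 1 by omega]
      exact fun he => hc₂.ne _ (σ.injective he)
  rcases h.enclosed_subset_union (show j ≤ m by omega) hx with hx | hx
  · obtain ⟨i, hi, hs⟩ := hc₁.guard x hx k
    have hle : i % (j + 1) ≤ j := Nat.lt_succ_iff.1 (Nat.mod_lt _ (by omega))
    refine ⟨i % (j + 1), ?_, hs.trans hsub₁⟩
    rw [cmod _ (by omega), cl _ hle, hc₁.periodic_mod, hi]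
  · obtain ⟨i, hi, hs⟩ := hc₂.guard x hx (σ.symm k)
    have hle : i % (m - j + 1) ≤ m - j := Nat.lt_succ_iff.1 (Nat.mod_lt _ (by omega))
    refine ⟨i % (m - j + 1) + j, ?_, hs.trans hsub₂⟩
    rw [cmod _ (by omega), cr _ (by omega), Nat.add_sub_cancel, hc₂.periodic_mod, hi,
      Equiv.apply_symm_apply]

/-- The vertices of a simple chain have a proper `3`-colouring each of whose colour classes guards
the enclosed region. -/
theorem IsSimpleChain.exists_coloring {f : ℕ → ℂ} {m : ℕ} (h : IsSimpleChain f m) :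
    ∃ col, IsGuardColoring f m col := by
  induction m using Nat.strong_induction_on generalizing f with
  | _ m ih =>
    rcases h.three_le.eq_or_lt with rfl | h4
    · refine ⟨fun i => Fin.ofNat 3 i, fun i => ?_, fun i hi => ?_, fun x hx k => ⟨k, ?_, ?_⟩⟩
      · ext
        simp
      · have := congrArg Fin.val hi
        simp at this
        omega
      · simp
      · exact h.convex_enclosed_triangle.segment_subset
          (Or.inl ⟨k, k.2, left_mem_edge f _⟩) hx
    · obtain ⟨r, j, h2, hj, hdis, hseg⟩ := h.exists_diagonal h4
      have hs := h.shift r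
      have hs' := hs.shift j
      obtain ⟨c₁, hc₁⟩ := ih (j + 1) (by omega) (hs.subChain h2 hj (by
        rw [h.carrier_shift]
        simpa using hdis))
      obtain ⟨c₂, hc₂⟩ := ih (m - j + 1) (by omega) (hs'.subChain (j := m - j) (by omega) (by omega) (by
        rw [hs.carrier_shift, h.carrier_shift, openSegment_symm]
        simp only [zero_add, Nat.sub_add_cancel (show j ≤ m by omega)]
        rw [add_comm m r, h.periodic r]
        exact hdis))
      obtain ⟨c, hc⟩ := hs.exists_coloring_of_diagonal h2 hj (by
        rw [h.carrier_shift]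
        simpa using hseg) hc₁ hc₂
      exact h.exists_coloring_of_shift r hc

end PlaneChain

/-! ### Transfer to polygons in the Euclidean plane -/

namespace UniversalGuards

open Set PlaneChain

/-- The identification of the plane with the complex numbers. -/
noncomputable def toComplex : Plane ≃ₗᵢ[ℝ] ℂ := Complex.orthonormalBasisOneI.repr.symm

theorem isBounded_image_toComplex {s : Set Plane} :
    Bornology.IsBounded (toComplex '' s) ↔ Bornology.IsBounded s := by
  refine ⟨fun h => ?_, fun h => toComplex.lipschitz.isBounded_image h⟩
  have := toComplex.antilipschitz.isBounded_preimage h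
  rwa [preimage_image_eq _ toComplex.injective] at this

/-- A linear isometry is a homeomorphism preserving boundedness, so it carries bounded components of
the complement to bounded components. -/
theorem toComplex_mem_enclosed {K : Set Plane} {x : Plane} :
    toComplex x ∈ enclosed (toComplex '' K) ↔
      x ∈ K ∪ {x | x ∉ K ∧ Bornology.IsBounded (connectedComponentIn Kᶜ x)} := by
  have hmem : toComplex x ∈ toComplex '' K ↔ x ∈ K := toComplex.injective.mem_set_image
  simp only [enclosed, mem_union, mem_ofPred_eq, hmem]
  refine or_congr_right (and_congr_right fun hx => ?_)
  rw [← image_compl_eq toComplex.bijective, ← isBounded_image_toComplex]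
  have := toComplex.toHomeomorph.image_connectedComponentIn (s := Kᶜ) (x := x) hx
  simp only [LinearIsometryEquiv.coe_toHomeomorph] at this
  rw [this]

theorem image_segment_toComplex (a b : Plane) :
    toComplex '' segment ℝ a b = segment ℝ (toComplex a) (toComplex b) :=
  image_segment ℝ toComplex.toLinearEquiv.toLinearMap.toAffineMap a b

section chain

variable {m : ℕ}

/-- The vertices of a polygon as a periodic sequence of complex numbers. -/
noncomputable def chain (c : Polygon Plane m) (hm : 0 < m) (i : ℕ) : ℂ :=
  toComplex (c.vertices ⟨i % m, Nat.mod_lt i hm⟩)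

theorem finRotate_mk (hm : 0 < m) (i : ℕ) :
    finRotate m ⟨i % m, Nat.mod_lt i hm⟩ = ⟨(i + 1) % m, Nat.mod_lt _ hm⟩ := by
  obtain ⟨n, rfl⟩ := Nat.exists_eq_succ_of_ne_zero hm.ne'
  rw [finRotate_apply]
  ext
  simp [Fin.val_add]

theorem edge_chain (c : Polygon Plane m) (hm : 0 < m) (i : ℕ) :
    edge (chain c hm) i = toComplex '' c.edgeSet ℝ ⟨i % m, Nat.mod_lt i hm⟩ := by
  rw [Polygon.edgeSet, affineSegment_eq_segment, image_segment_toComplex, finRotate_mk hm]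
  rfl

theorem carrier_chain (c : Polygon Plane m) (hm : 0 < m) :
    carrier (chain c hm) m = toComplex '' c.boundary ℝ := by
  rw [Polygon.boundary, image_iUnion]
  ext z
  simp only [carrier, mem_ofPred_eq, mem_iUnion, edge_chain]
  constructor
  · rintro ⟨i, -, hz⟩
    exact ⟨_, hz⟩
  · rintro ⟨i, hz⟩
    refine ⟨i, i.2, ?_⟩
    simpa only [Nat.mod_eq_of_lt i.2] using hz

/-- For `i < j < m`, cyclic adjacency means either `j = i + 1` or the wrap-around pair `i = 0`, `j =
m - 1`; these are the two alternatives of `meet`. -/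
theorem isSimpleChain_chain {c : Polygon Plane m} (hc : c.IsSimple) (hm : 0 < m) :
    IsSimpleChain (chain c hm) m := by
  refine ⟨hc.three_le, fun i => by simp [chain], fun i hi j hj hij => ?_,
    fun i j hij hj y hyi hyj => ?_⟩
  · have := hc.injective (toComplex.injective hij)
    simpa [Nat.mod_eq_of_lt hi, Nat.mod_eq_of_lt hj] using this
  have hi : i < m := hij.trans hj
  have hri := finRotate_mk hm i
  have hrj := finRotate_mk hm j
  rw [edge_chain] at hyi hyj
  simp only [Nat.mod_eq_of_lt hi, Nat.mod_eq_of_lt hj] at hyi hyj hri hrj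
  obtain ⟨y, hy, rfl⟩ := hyi
  rw [toComplex.injective.mem_set_image] at hyj
  have hlt := fun k => Nat.mod_eq_of_lt (a := k) (b := m)
  by_cases h1 : (⟨j, hj⟩ : Fin m) = finRotate m ⟨i, hi⟩
  · left
    have hv := hc.consecutive ⟨i, hi⟩
    rw [← h1] at hv
    have hy1 : y = c.vertices ⟨j, hj⟩ := by
      have : y ∈ ({c.vertices ⟨j, hj⟩} : Set Plane) := hv ▸ ⟨hy, hyj⟩
      exact this
    rw [hri, Fin.mk.injEq] at h1
    refine ⟨?_, by simp only [hy1, chain, Nat.mod_eq_of_lt hj]⟩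
    rcases (Nat.succ_le_of_lt hi).lt_or_eq with h2 | h2
    · rwa [hlt _ h2] at h1
    · rw [Nat.succ_eq_add_one] at h2
      rw [h2, Nat.mod_self] at h1
      omega
  by_cases h2 : (⟨i, hi⟩ : Fin m) = finRotate m ⟨j, hj⟩
  · right
    have hv := hc.consecutive ⟨j, hj⟩
    rw [← h2] at hv
    have hy1 : y = c.vertices ⟨i, hi⟩ := by
      have : y ∈ ({c.vertices ⟨i, hi⟩} : Set Plane) := hv ▸ ⟨hyj, hy⟩
      exact this
    rw [hrj, Fin.mk.injEq] at h2
    rcases (Nat.succ_le_of_lt hj).lt_or_eq with h3 | h3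
    · rw [hlt _ h3] at h2
      omega
    · rw [Nat.succ_eq_add_one] at h3
      rw [h3, Nat.mod_self] at h2
      subst h2
      exact ⟨rfl, h3, by simp only [hy1, chain, Nat.zero_mod]⟩
  · exact absurd hyj (disjoint_left.1 (hc.nonconsecutive ⟨i, hi⟩ ⟨j, hj⟩
      (fun h => hij.ne (Fin.mk.inj h)) h1 h2) hy)

/-- The vertices of a simple polygon have a `3`-colouring each of whose colour classes guards
the polygon. -/
theorem exists_vertex_coloring {c : Polygon Plane m} (hc : c.IsSimple) :
    ∃ col : Fin m → Fin 3, ∀ x ∈ c.region, ∀ k, ∃ i, col i = k ∧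
      segment ℝ (c.vertices i) x ⊆ c.region := by
  have hm : 0 < m := by have := hc.three_le; omega
  have hreg : ∀ x, toComplex x ∈ enclosed (carrier (chain c hm) m) ↔ x ∈ c.region := fun x => by
    rw [carrier_chain]
    exact toComplex_mem_enclosed
  obtain ⟨col, hcol⟩ := (isSimpleChain_chain hc hm).exists_coloring
  refine ⟨fun i => col i, fun x hx k => ?_⟩
  obtain ⟨i, hi, hs⟩ := hcol.guard _ ((hreg x).2 hx) k
  refine ⟨⟨i % m, Nat.mod_lt i hm⟩, by simpa [hcol.periodic_mod] using hi, fun z hz => ?_⟩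
  rw [← hreg]
  apply hs
  rw [chain, ← image_segment_toComplex]
  exact mem_image_of_mem _ hz

theorem vertices_mem_region (c : Polygon Plane m) (i : Fin m) : c.vertices i ∈ c.region :=
  Or.inl (mem_iUnion.2 ⟨i, left_mem_affineSegment ℝ _ _⟩)

end chain

/-! ### Choosing common guards and counting -/

theorem IsGuardSet.mono {P : Set Plane} {G H : Finset Plane} (h : IsGuardSet P G) (hGH : G ⊆ H) :
    IsGuardSet P H := by
  apply Subset.antisymm
  · exact iUnion₂_subset fun g _ x hx => hx.1
  · exact h.symm.subset.trans (biUnion_subset_biUnion_left hGH)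

/-- The vertices of a simple polygon split into three guard sets. -/
theorem exists_guard_coloring {S : Finset Plane} {P : Set Plane} (hP : P ∈ simplePolygons S) :
    ∃ col : Plane → Fin 3, ∀ k, IsGuardSet P (S.filter fun s => col s = k) := by
  obtain ⟨m, c, hc, hS, rfl⟩ := hP
  obtain ⟨col, hcol⟩ := exists_vertex_coloring hc
  -- The default colour `0` is never used on `S`, which is exactly the range of the vertices.
  refine ⟨Function.extend c.vertices col 0, fun k => ?_⟩
  apply Subset.antisymm
  · exact iUnion₂_subset fun g _ x hx => hx.1
  · intro x hx
    obtain ⟨i, hi, hs⟩ := hcol x hx k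
    refine mem_iUnion₂.2 ⟨c.vertices i, Finset.mem_filter.2 ⟨?_, ?_⟩, hx,
      vertices_mem_region c i, hx, hs⟩
    · rw [← Finset.mem_coe, ← hS]
      exact mem_range_self i
    · rw [hc.injective.extend_apply, hi]

theorem exists_color_card_le (R : Finset Plane) (col : Plane → Fin 3) :
    ∃ k, 3 * (R.filter fun s => col s = k).card ≤ R.card := by
  by_contra! hcon
  have h := Finset.card_eq_sum_card_fiberwise (s := R) (t := Finset.univ) (f := col)
    (fun _ _ => Finset.mem_coe.2 (Finset.mem_univ _))
  rw [Fin.sum_univ_three] at h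
  have h0 := hcon 0
  have h1 := hcon 1
  have h2 := hcon 2
  omega

open Classical in
/-- A finite family of simple polygons with vertex set `S` has a common guard set that leaves out
a large part of `S`. -/
theorem exists_guards_card_sdiff (S : Finset Plane) (A : Finset (Set Plane))
    (hA : ∀ P ∈ A, P ∈ simplePolygons S) :
    ∃ G ⊆ S, (∀ P ∈ A, IsGuardSet P G) ∧
      (2 / 3 : ℝ) ^ A.card * S.card ≤ ((S \ G).card : ℝ) := by
  induction A using Finset.induction_on with
  | empty => exact ⟨∅, by simp, by simp, by simp⟩
  | insert P A hPA ih =>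
    obtain ⟨G, hGS, hG, hcard⟩ := ih fun Q hQ => hA Q (Finset.mem_insert_of_mem hQ)
    obtain ⟨col, hcol⟩ := exists_guard_coloring (hA P (Finset.mem_insert_self P A))
    -- The smallest class is taken among the points of `S \ G` only: vertices already chosen cost
    -- nothing.
    obtain ⟨k, hk⟩ := exists_color_card_le (S \ G) col
    refine ⟨G ∪ S.filter fun s => col s = k,
      Finset.union_subset hGS (Finset.filter_subset _ _), fun Q hQ => ?_, ?_⟩
    · rcases Finset.mem_insert.1 hQ with rfl | hQ
      · exact (hcol k).mono Finset.subset_union_right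
      · exact (hG Q hQ).mono Finset.subset_union_left
    · have h1 : S \ (G ∪ S.filter fun s => col s = k)
          = (S \ G).filter fun s => ¬ col s = k := by
        ext s
        simp only [Finset.mem_sdiff, Finset.mem_union, Finset.mem_filter]
        tauto
      have h2 := Finset.card_filter_add_card_filter_not (s := S \ G) (fun s => col s = k)
      have h3 : (2 : ℝ) * (S \ G).card ≤
          3 * ((S \ G).filter fun s => ¬ col s = k).card := by
        have : 2 * (S \ G).card ≤ 3 * ((S \ G).filter fun s => ¬ col s = k).card := by omega
        exact_mod_cast this
      rw [h1, Finset.card_insert_of_notMem hPA, pow_succ]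
      linarith

theorem exists_commonGuardSet (S : Finset Plane) (A : Set (Set Plane)) {k : ℕ}
    (hA : A ⊆ simplePolygons S) (hk : A.encard = (k : ℕ∞)) :
    ∃ G : Finset Plane, IsCommonGuardSet S A G ∧
      (G.card : ℝ) ≤ (1 - (2 / 3 : ℝ) ^ k) * (S.card : ℝ) := by
  classical
  have hfin : A.Finite := finite_of_encard_eq_coe hk
  have hcard : hfin.toFinset.card = k := by
    rw [hfin.encard_eq_coe_toFinset_card] at hk
    exact_mod_cast hk
  obtain ⟨G, hGS, hG, hle⟩ := exists_guards_card_sdiff S hfin.toFinset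
    fun P hP => hA (hfin.mem_toFinset.1 hP)
  refine ⟨G, ⟨hGS, fun P hP => hG P (hfin.mem_toFinset.2 hP)⟩, ?_⟩
  have h1 := Finset.card_sdiff_add_card_eq_card hGS
  have h2 : ((S \ G).card : ℝ) + G.card = S.card := by exact_mod_cast h1
  rw [hcard] at hle
  linarith

end UniversalGuards

theorem mainTheorem7 (n k : ℕ) :
    (UniversalGuards.kUniversalGuardNumber n k : ℝ≥0∞) ≤
        ENNReal.ofReal ((1 - (2 / 3 : ℝ) ^ k) * (n : ℝ)) ∧
      ∀ S : Finset Plane, S.card = n →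
        ∀ A : Set (Set Plane), A ⊆ UniversalGuards.simplePolygons S → A.encard = (k : ℕ∞) →
          ∃ G : Finset Plane, UniversalGuards.IsCommonGuardSet S A G ∧
            (G.card : ℝ) ≤ (1 - (2 / 3 : ℝ) ^ k) * (n : ℝ) := by
  have hmain : ∀ S : Finset Plane, S.card = n →
      ∀ A : Set (Set Plane), A ⊆ UniversalGuards.simplePolygons S → A.encard = (k : ℕ∞) →
        ∃ G : Finset Plane, UniversalGuards.IsCommonGuardSet S A G ∧
          (G.card : ℝ) ≤ (1 - (2 / 3 : ℝ) ^ k) * (n : ℝ) := by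
    rintro S rfl A hA hk
    exact UniversalGuards.exists_commonGuardSet S A hA hk
  refine ⟨?_, hmain⟩
  set r : ℝ := (1 - (2 / 3 : ℝ) ^ k) * (n : ℝ) with hr
  have hr0 : 0 ≤ r :=
    mul_nonneg (sub_nonneg.2 (pow_le_one₀ (by norm_num) (by norm_num))) n.cast_nonneg
  -- Guard numbers are extended naturals, so the real bound passes through its floor before the
  -- supremum is taken.
  have hle : UniversalGuards.kUniversalGuardNumber n k ≤ ((⌊r⌋₊ : ℕ) : ℕ∞) := by
    refine iSup₂_le fun S hS => iSup₂_le fun A hA => iSup_le fun hk => ?_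
    obtain ⟨G, hG, hcard⟩ := hmain S hS A hA hk
    refine (iInf₂_le G hG).trans ?_
    exact_mod_cast Nat.le_floor hcard
  calc (UniversalGuards.kUniversalGuardNumber n k : ℝ≥0∞)
      ≤ (((⌊r⌋₊ : ℕ) : ℕ∞) : ℝ≥0∞) := ENat.toENNReal_le.2 hle
    _ = ENNReal.ofReal (⌊r⌋₊ : ℝ) := by simp
    _ ≤ ENNReal.ofReal r := ENNReal.ofReal_le_ofReal (Nat.floor_le hr0)
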